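/- Let $M$ be a smooth $D$-dimensional manifold with a smooth pseudo-Riemannian metric $g$ of arbitrary signature and a spin structure, with Levi-Civita connection $\nabla$ (no torsion). Let $S$ be a finite-dimensional complex Clifford module, with $\gamma^a\gamma^b+\gamma^b\gamma^a=2g^{ab}$, and let $\nabla$ also denote the induced spin connection on the associated spinor bundle. Let $A$ be a smooth real 1-form on $M$ with field strength $F=dA$, i.e. $F_{ab}=\partial_aA_b-\partial_bA_a$, let $e\in\mathbb R$, and let $\mathcal D=\gamma^a(\nabla_a-\mathrm{i}eA_a)$ be the charged Dirac operator. Square brackets denote antisymmetrization with weight one, and $\gamma^{a_1\ldots a_k}=\gamma^{[a_1}\cdots\gamma^{a_k]}$ (the identity if $k=0$). Let $p\ge 1$ and let $Y$ be a smooth Killing–Yano $p$-form, i.e. a $p$-form with $$\nabla_aY_{b_1\ldots b_p}=\nabla_{[a}Y_{b_1\ldots b_p]},$$ and suppose that $$F^b{}_{[a_1}Y_{a_2\ldots a_p]b}=0 .$$ Then the operator $$K_Y=\gamma^{b_1\ldots b_{p-1}}\,Y^a{}_{b_1\ldots b_{p-1}}(\nabla_a-\mathrm{i}eA_a)+\frac1{2(p+1)}\gamma^{b_1\ldots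 b_{p+1}}\nabla_{b_1}Y_{b_2\ldots b_{p+1}}$$ graded anticommutes with $\mathcal D$: for every smooth spinor field $\psi$, $$\mathcal D K_Y\psi+(-1)^pK_Y\mathcal D\psi=0 .$$ -/

import Mathlib

open scoped Manifold ContDiff

noncomputable section

namespace KillingYano

/-- Antisymmetrization with weight one,
`T_{[a_1 … a_k]} = (1 / k!) ∑_σ sign(σ) T_{a_{σ 1} … a_{σ k}}`. -/
def antisymm {D k : ℕ} {V : Type*} [AddCommGroup V] [Module ℝ V]
    (T : (Fin k → Fin D) → V) (a : Fin k → Fin D) : V :=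
  (k.factorial : ℝ)⁻¹ • ∑ s : Equiv.Perm (Fin k), ((Equiv.Perm.sign s : ℤ) : ℝ) • T (a ∘ s)

section Manifold

variable {D : ℕ} {M : Type*} [TopologicalSpace M] [ChartedSpace (EuclideanSpace ℝ (Fin D)) M]
  [IsManifold (𝓡 D) ∞ M]

variable (D M) in
/-- Vector fields (not necessarily smooth) on the `D`-dimensional manifold `M`. -/
abbrev VField : Type _ := ∀ x : M, TangentSpace (𝓡 D) x

variable (D M) in
/-- Fields of alternating covariant `p`-tensors (not necessarily smooth) on `M`. -/
abbrev FormField (p : ℕ) : Type _ := ∀ x : M, (TangentSpace (𝓡 D) x) [⋀^Fin p]→ₗ[ℝ] ℝ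

variable (D M) in
/-- Fields of covectors (not necessarily smooth) on `M`. -/
abbrev CovectorField : Type _ := ∀ x : M, TangentSpace (𝓡 D) x →ₗ[ℝ] ℝ

/-- The vector field `X` is smooth on the set `U`. -/
def IsSmoothVFieldOn (X : VField D M) (U : Set M) : Prop :=
  ContMDiffOn (𝓡 D) (𝓡 D).tangent ∞ (fun x => (⟨x, X x⟩ : TangentBundle (𝓡 D) M)) U

/-- A `p`-form is smooth if it takes smooth values on smooth vector fields on open sets. -/
def IsSmoothForm {p : ℕ} (Y : FormField D M p) : Prop :=
  ∀ (U : Set M) (X : Fin p → VField D M), IsOpen U → (∀ i, IsSmoothVFieldOn (X i) U) →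
    ContMDiffOn (𝓡 D) 𝓘(ℝ, ℝ) ∞ (fun x => Y x fun i => X i x) U

/-- A 1-form is smooth if it takes smooth values on smooth vector fields on open sets. -/
def IsSmoothCovector (A : CovectorField D M) : Prop :=
  ∀ (U : Set M) (X : VField D M), IsOpen U → IsSmoothVFieldOn X U →
    ContMDiffOn (𝓡 D) 𝓘(ℝ, ℝ) ∞ (fun x => A x (X x)) U

variable (D M) in
/-- A smooth pseudo-Riemannian metric (of any signature) on `M`. -/
structure PseudoMetric where
  val : ∀ x : M, LinearMap.BilinForm ℝ (TangentSpace (𝓡 D) x)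
  symm : ∀ x v w, val x v w = val x w v
  nondegenerate : ∀ x, (val x).Nondegenerate
  smooth : ∀ (U : Set M) (X Z : VField D M), IsOpen U →
    IsSmoothVFieldOn X U → IsSmoothVFieldOn Z U →
    ContMDiffOn (𝓡 D) 𝓘(ℝ, ℝ) ∞ (fun x => val x (X x) (Z x)) U

/-- The derivative `X(f)` of a vector-valued function `f` along the vector field `X`. -/
def dirDeriv {V : Type*} [NormedAddCommGroup V] [NormedSpace ℝ V]
    (X : VField D M) (f : M → V) (x : M) : V :=
  mvfderiv (𝓡 D) f x (X x)

/-- The Lie bracket of vector fields. -/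
def bracket (X Z : VField D M) : VField D M := VectorField.mlieBracket (𝓡 D) X Z

/-- The Levi-Civita connection of `g` through the Koszul formula:
`koszul g X Z W = g(∇_X Z, W)`. -/
def koszul (g : PseudoMetric D M) (X Z W : VField D M) (x : M) : ℝ :=
  (1 / 2 : ℝ) *
    (dirDeriv X (fun y => g.val y (Z y) (W y)) x
      + dirDeriv Z (fun y => g.val y (W y) (X y)) x
      - dirDeriv W (fun y => g.val y (X y) (Z y)) x
      + g.val x (bracket X Z x) (W x)
      - g.val x (bracket Z W x) (X x)
      + g.val x (bracket W X x) (Z x))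

/-- The field strength `F = dA`, as `F(X, Z) = X(A(Z)) - Z(A(X)) - A([X, Z])`;
in coordinates `F_{ab} = ∂_a A_b - ∂_b A_a`. -/
def fieldStrength (A : CovectorField D M) (X Z : VField D M) (x : M) : ℝ :=
  dirDeriv X (fun y => A y (Z y)) x - dirDeriv Z (fun y => A y (X y)) x - A x (bracket X Z x)

/-- `E` is a smooth pseudo-orthonormal frame on `U`, `g(E_i, E_j) = η_i δ_{ij}`.
Here and below `η_i = ±1` is the signature; frame indices are raised by multiplication
with `η_i`. -/
structure IsOrthonormalFrameOn (g : PseudoMetric D M) (η : Fin D → ℝ)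
    (E : Fin D → VField D M) (U : Set M) : Prop where
  smooth : ∀ i, IsSmoothVFieldOn (E i) U
  orthonormal : ∀ x ∈ U, ∀ i j, g.val x (E i x) (E j x) = if i = j then η i else 0

/-- The frame component `(∇_{c_0} Y)_{c_1 … c_p}` of the Levi-Civita derivative of a `p`-form,
`E_{c_0}(Y(E_{c_1}, …, E_{c_p})) - ∑_k Y(E_{c_1}, …, ∇_{E_{c_0}} E_{c_k}, …, E_{c_p})`. -/
def covDerivForm (g : PseudoMetric D M) (η : Fin D → ℝ) (E : Fin D → VField D M)
    {p : ℕ} (Y : FormField D M p) (x : M) (c : Fin (p + 1) → Fin D) : ℝ :=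
  dirDeriv (E (c 0)) (fun y => Y y fun k : Fin p => E (c k.succ) y) x
    - ∑ k : Fin p, Y x (Function.update (fun l : Fin p => E (c l.succ) x) k
        (∑ m, (η m * koszul g (E (c 0)) (E (c k.succ)) (E m) x) • E m x))

/-- `Y` is a Killing–Yano `p`-form: `∇_a Y_{b_1 … b_p} = ∇_{[a} Y_{b_1 … b_p]}`,
in every local orthonormal frame. -/
def IsKillingYano (g : PseudoMetric D M) (η : Fin D → ℝ) {p : ℕ} (Y : FormField D M p) : Prop :=
  ∀ (U : Set M) (E : Fin D → VField D M), IsOpen U → IsOrthonormalFrameOn g η E U →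
    ∀ x ∈ U, ∀ c, covDerivForm g η E Y x c = antisymm (covDerivForm g η E Y x) c

/-- The algebraic condition `F^b_{[a_1} Y_{a_2 … a_p] b} = 0` with `p = n + 1`,
in every local orthonormal frame. -/
def LiftCondition (g : PseudoMetric D M) (η : Fin D → ℝ) (A : CovectorField D M) {n : ℕ}
    (Y : FormField D M (n + 1)) : Prop :=
  ∀ (U : Set M) (E : Fin D → VField D M), IsOpen U → IsOrthonormalFrameOn g η E U →
    ∀ x ∈ U, ∀ a : Fin (n + 1) → Fin D,
      antisymm (fun a' : Fin (n + 1) → Fin D =>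
        ∑ b, η b * fieldStrength A (E b) (E (a' 0)) x *
          Y x (Fin.snoc (fun k : Fin n => E (a' k.succ) x) (E b x))) a = 0

end Manifold

section Spin

variable {D : ℕ}

/-- The quadratic form `v ↦ ∑ i, η i * v i ^ 2` on `ℝ^D`. Its Clifford algebra has
`γ_i γ_j + γ_j γ_i = 2 η_i δ_{ij}`. -/
abbrev signForm (η : Fin D → ℝ) : QuadraticForm ℝ (Fin D → ℝ) :=
  QuadraticMap.weightedSumSquares ℝ η

/-- The generator of the Clifford algebra given by the `i`-th standard basis vector. -/
def cliffordBasis (η : Fin D → ℝ) (i : Fin D) : CliffordAlgebra (signForm η) :=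
  CliffordAlgebra.ι (signForm η) (Pi.single i 1)

variable {M : Type*} [TopologicalSpace M] [ChartedSpace (EuclideanSpace ℝ (Fin D)) M]
  [IsManifold (𝓡 D) ∞ M]

/-- A spin structure on the pseudo-Riemannian manifold `(M, g)` of signature `η`, by local
trivializations: an open cover, a local orthonormal frame on every member of it, and a smooth
cocycle `trans` with values in the spin group that lifts the transition matrices of the frames.
An element `s` of the spin group is an even element of the Clifford algebra with
`star s * s = ±1` for which conjugation maps vectors to vectors; the last property is contained
in `lifts`, since `E_{β j} = ∑_i η_i g(E_{α i}, E_{β j}) E_{α i}`. -/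
structure SpinStructure (g : PseudoMetric D M) (η : Fin D → ℝ) (I : Type*) where
  signature : ∀ i, η i = 1 ∨ η i = -1
  dom : I → Set M
  isOpen_dom : ∀ α, IsOpen (dom α)
  covers : ∀ x, ∃ α, x ∈ dom α
  frame : I → Fin D → VField D M
  orthonormal : ∀ α, IsOrthonormalFrameOn g η (frame α) (dom α)
  trans : I → I → M → CliffordAlgebra (signForm η)
  trans_smooth : ∀ α β (l : CliffordAlgebra (signForm η) →ₗ[ℝ] ℝ),
    ContMDiffOn (𝓡 D) 𝓘(ℝ, ℝ) ∞ (fun x => l (trans α β x)) (dom α ∩ dom β)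
  trans_even : ∀ α β, ∀ x ∈ dom α ∩ dom β, trans α β x ∈ CliffordAlgebra.even (signForm η)
  trans_norm : ∀ α β, ∀ x ∈ dom α ∩ dom β,
    star (trans α β x) * trans α β x = 1 ∨ star (trans α β x) * trans α β x = -1
  lifts : ∀ α β, ∀ x ∈ dom α ∩ dom β, ∀ j,
    trans α β x * cliffordBasis η j =
      (∑ i, (η i * g.val x (frame α i x) (frame β j x)) • cliffordBasis η i) * trans α β x
  cocycle : ∀ α β δ, ∀ x ∈ dom α ∩ dom β ∩ dom δ,
    trans α β x * trans β δ x = trans α δ x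

variable {g : PseudoMetric D M} {η : Fin D → ℝ} {I : Type*}
  {S : Type*} [NormedAddCommGroup S] [NormedSpace ℂ S]

/-- A smooth section of the spinor bundle with fibre `S` associated with a spin structure and
a complex Clifford module `(S, ρ)`, by its representatives `ψ α : M → S` on the members of the
cover (the values of `ψ α` outside `dom α` are irrelevant). -/
structure IsSpinorField (P : SpinStructure g η I)
    (ρ : CliffordAlgebra (signForm η) →ₐ[ℝ] Module.End ℂ S) (ψ : I → M → S) : Prop where
  smooth : ∀ α, ContMDiffOn (𝓡 D) 𝓘(ℝ, S) ∞ (ψ α) (P.dom α)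
  compatible : ∀ α β, ∀ x ∈ P.dom α ∩ P.dom β, ψ α x = ρ (P.trans α β x) (ψ β x)

/-- The gamma matrix `γ^i`, with upper frame index: `γ^i γ^j + γ^j γ^i = 2 g^{ij}`. -/
def gamma (ρ : CliffordAlgebra (signForm η) →ₐ[ℝ] Module.End ℂ S) (i : Fin D) : Module.End ℂ S :=
  η i • ρ (cliffordBasis η i)

/-- The antisymmetrized product `γ^{a_1 … a_k} = γ^{[a_1} ⋯ γ^{a_k]}`. -/
def gammaAnti (ρ : CliffordAlgebra (signForm η) →ₐ[ℝ] Module.End ℂ S) {k : ℕ}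
    (a : Fin k → Fin D) : Module.End ℂ S :=
  antisymm (fun a' : Fin k → Fin D => (List.ofFn fun l => gamma ρ (a' l)).prod) a

/-- The spin connection in a local trivialization:
`∇_i ψ = E_i(ψ) + (1/4) ∑_{j,k} ω_{i j k} γ^j γ^k ψ` with `ω_{i j k} = g(E_j, ∇_{E_i} E_k)`. -/
def spinDeriv (P : SpinStructure g η I)
    (ρ : CliffordAlgebra (signForm η) →ₐ[ℝ] Module.End ℂ S) (i : Fin D) (ψ : I → M → S) :
    I → M → S := fun α x =>
  dirDeriv (P.frame α i) (ψ α) x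
    + (1 / 4 : ℝ) • ∑ j, ∑ k, koszul g (P.frame α i) (P.frame α k) (P.frame α j) x •
        (gamma ρ j * gamma ρ k) (ψ α x)

/-- The charged covariant derivative `∇_i - i e A_i` of spinor fields. -/
def chargedDeriv (P : SpinStructure g η I)
    (ρ : CliffordAlgebra (signForm η) →ₐ[ℝ] Module.End ℂ S) (A : CovectorField D M) (e : ℝ)
    (i : Fin D) (ψ : I → M → S) : I → M → S := fun α x =>
  spinDeriv P ρ i ψ α x - (Complex.I * (e : ℂ) * (A x (P.frame α i x) : ℂ)) • ψ α x

/-- The charged Dirac operator `γ^a (∇_a - i e A_a)`. -/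
def diracOp (P : SpinStructure g η I)
    (ρ : CliffordAlgebra (signForm η) →ₐ[ℝ] Module.End ℂ S) (A : CovectorField D M) (e : ℝ)
    (ψ : I → M → S) : I → M → S := fun α x =>
  ∑ a, gamma ρ a (chargedDeriv P ρ A e a ψ α x)

/-- The operator
`K_Y = γ^{b_1 … b_{p-1}} Y^a_{b_1 … b_{p-1}} (∇_a - i e A_a)
  + (1 / (2 (p + 1))) γ^{b_1 … b_{p+1}} ∇_{b_1} Y_{b_2 … b_{p+1}}`
of a `p`-form `Y` with `p = n + 1`. -/
def kyOp (P : SpinStructure g η I)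
    (ρ : CliffordAlgebra (signForm η) →ₐ[ℝ] Module.End ℂ S) (A : CovectorField D M) (e : ℝ)
    {n : ℕ} (Y : FormField D M (n + 1)) (ψ : I → M → S) : I → M → S := fun α x =>
  (∑ b : Fin n → Fin D, ∑ a : Fin D,
      (η a * Y x (Fin.cons (P.frame α a x) fun k : Fin n => P.frame α (b k) x)) •
        gammaAnti ρ b (chargedDeriv P ρ A e a ψ α x))
    + (1 / (2 * ((n + 1 : ℕ) + 1)) : ℝ) • ∑ b : Fin (n + 2) → Fin D,
        covDerivForm g η (P.frame α) Y x b • gammaAnti ρ b (ψ α x)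

end Spin

end KillingYano

end

set_option linter.unusedSectionVars false

noncomputable section

namespace KillingYano

/-! ### Calculus of vector fields: directional derivatives and Lie brackets. -/

section Geometry

variable {D : ℕ} {M : Type*} [TopologicalSpace M] [ChartedSpace (EuclideanSpace ℝ (Fin D)) M]
  {V : Type*} [NormedAddCommGroup V] [NormedSpace ℝ V] {U : Set M}

/-! Write `y = Y_{b₁…b_p} γ^{b₁}⋯γ^{b_p}` for Clifford multiplication by `Y`, `P` for the Dirac
operator, `ε = (-1)^p`, `r = p + 1` and `t = γ^c (∇_c y)`. Moving one gamma matrix through `y` gives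
`2p Y^a_{…}γ^{…} = γ^a y - ε y γ^a`, hence `2p K_Y = P y - ε y P - r⁻¹ t`. In the graded
anticommutator the terms `ε P y P` cancel, so the claim becomes `[P², y] = r⁻¹ (P t + ε t P)`.

Here `P² = □ + C/2`, where `□` is the trace of the second covariant derivative and `C = γ^a γ^c
[curvature]_{ac}`. The Riemann part of `C` is a scalar by the first Bianchi identity (Lichnerowicz).
Its electromagnetic part is a multiple of `F_{ac} γ^a γ^c`, whose commutator with `y` is the action
of `F` as a derivation on `Y`; the condition on `F` and `Y` says that this action vanishes. So `[P²,
y] = [□, y] = □y + 2 ∇^a y ∇_a`, where `∇_a` includes the charge term when it acts on spinors.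

By the Killing–Yano equation `∇Y` is totally antisymmetric, so contraction gives `2r ∇_c y = γ_c t +
ε t γ_c` and `(∇_a y) γ^a = ε t`. The first identity makes the first-order terms agree and leaves `r
□y = γ^a γ^c ∇_a ∇_c y`. This is the divergence of the same identity (`sum_ddElt_diag`): exchanging
the two derivatives costs `γ^c [R_{ac}, y] γ^a`, which vanishes by Bianchi and the symmetry of the
Ricci tensor (`sum_gamma_commutator_curvatureGamma`).

The argument is carried out once in an abstract ring (`DiracAlgebra.graded_anticommute`). The ring
is then taken to be the endomorphisms of the smooth spinor-valued functions on one trivializing open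
set, and `graded_anticommute_symmetryOp` checks the hypotheses there. -/

lemma mdifferentiableAt_of_contMDiffOn (hU : IsOpen U) {f : M → V}
    (hf : ContMDiffOn (𝓡 D) 𝓘(ℝ, V) ∞ f U) {x : M} (hx : x ∈ U) :
    MDifferentiableAt (𝓡 D) 𝓘(ℝ, V) f x :=
  (hf.contMDiffAt (hU.mem_nhds hx)).mdifferentiableAt (by simp)

lemma dirDeriv_congr (hU : IsOpen U) {X : VField D M} {f f' : M → V} (h : Set.EqOn f f' U)
    {x : M} (hx : x ∈ U) : dirDeriv X f x = dirDeriv X f' x := by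
  have : f =ᶠ[nhds x] f' := Filter.eventuallyEq_of_mem (hU.mem_nhds hx) h
  simp only [dirDeriv, mvfderiv, this.mfderiv_eq]
  rw [h hx]

lemma bracket_congr_right (hU : IsOpen U) {X Z Z' : VField D M} (h : ∀ y ∈ U, Z y = Z' y)
    {x : M} (hx : x ∈ U) : bracket X Z x = bracket X Z' x :=
  Filter.EventuallyEq.mlieBracket_vectorField_eq Filter.EventuallyEq.rfl
    (Filter.eventuallyEq_of_mem (hU.mem_nhds hx) h)

lemma bracket_swap (X Z : VField D M) (x : M) : bracket X Z x = -bracket Z X x :=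
  VectorField.mlieBracket_swap_apply

lemma dirDeriv_const (X : VField D M) (c : V) (x : M) : dirDeriv X (fun _ => c) x = 0 := by
  simp [dirDeriv, mvfderiv_const]

lemma dirDeriv_sum_vfield {ι : Type*} (s : Finset ι) (c : ι → ℝ) (X : VField D M)
    (Z : ι → VField D M) (f : M → V) (x : M) (h : X x = ∑ i ∈ s, c i • Z i x) :
    dirDeriv X f x = ∑ i ∈ s, c i • dirDeriv (Z i) f x := by
  simp [dirDeriv, h, map_sum]

lemma dirDeriv_add (hU : IsOpen U) {X : VField D M} {f f' : M → V}
    (hf : ContMDiffOn (𝓡 D) 𝓘(ℝ, V) ∞ f U) (hf' : ContMDiffOn (𝓡 D) 𝓘(ℝ, V) ∞ f' U)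
    {x : M} (hx : x ∈ U) : dirDeriv X (f + f') x = dirDeriv X f x + dirDeriv X f' x := by
  simp [dirDeriv, mvfderiv_add (mdifferentiableAt_of_contMDiffOn hU hf hx)
    (mdifferentiableAt_of_contMDiffOn hU hf' hx)]

lemma dirDeriv_smul (hU : IsOpen U) {X : VField D M} {f : M → ℝ} {f' : M → V}
    (hf : ContMDiffOn (𝓡 D) 𝓘(ℝ, ℝ) ∞ f U) (hf' : ContMDiffOn (𝓡 D) 𝓘(ℝ, V) ∞ f' U)
    {x : M} (hx : x ∈ U) :
    dirDeriv X (f • f') x = f x • dirDeriv X f' x + dirDeriv X f x • f' x := by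
  simp [dirDeriv, mvfderiv_smul (mdifferentiableAt_of_contMDiffOn hU hf hx)
    (mdifferentiableAt_of_contMDiffOn hU hf' hx)]

lemma dirDeriv_clm {W : Type*} [NormedAddCommGroup W] [NormedSpace ℝ W] (hU : IsOpen U)
    {X : VField D M} (l : V →L[ℝ] W) {f : M → V}
    (hf : ContMDiffOn (𝓡 D) 𝓘(ℝ, V) ∞ f U) {x : M} (hx : x ∈ U) :
    dirDeriv X (fun y => l (f y)) x = l (dirDeriv X f x) := by
  have h := mfderiv_comp x (l.mdifferentiableAt (x := f x))
    (mdifferentiableAt_of_contMDiffOn hU hf hx)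
  simp only [dirDeriv, mvfderiv]
  change mfderiv (𝓡 D) 𝓘(ℝ, W) (l ∘ f) x (X x) = _
  rw [h, ContinuousLinearMap.mfderiv_eq]
  rfl

variable [IsManifold (𝓡 D) ∞ M]

lemma contMDiffOn_dirDeriv (hU : IsOpen U) {X : VField D M} (hX : IsSmoothVFieldOn X U)
    {f : M → V} (hf : ContMDiffOn (𝓡 D) 𝓘(ℝ, V) ∞ f U) :
    ContMDiffOn (𝓡 D) 𝓘(ℝ, V) ∞ (dirDeriv X f) U := by
  have : IsManifold (𝓡 D) 1 M := IsManifold.of_le (n := ∞) (by simp)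
  have h1 := hf.contMDiffOn_tangentMapWithin (m := ∞) (by simp) hU.uniqueMDiffOn
  have h2 := h1.comp hX (fun x hx => by simpa using hx)
  have h3 := (contMDiff_snd_tangentBundle_modelSpace V 𝓘(ℝ, V) (n := ∞)).comp_contMDiffOn h2
  refine h3.congr fun x hx => ?_
  simp only [dirDeriv, mvfderiv, Function.comp, tangentMapWithin]
  rw [mfderivWithin_of_isOpen hU hx]
  rfl

lemma IsSmoothVFieldOn.contMDiffAt {X : VField D M} (hX : IsSmoothVFieldOn X U) (hU : IsOpen U)
    {x : M} (hx : x ∈ U) :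
    ContMDiffAt (𝓡 D) (𝓡 D).tangent ∞ (fun x => (⟨x, X x⟩ : TangentBundle (𝓡 D) M)) x :=
  ContMDiffOn.contMDiffAt hX (hU.mem_nhds hx)

lemma IsSmoothVFieldOn.mdifferentiableAt {X : VField D M} (hX : IsSmoothVFieldOn X U)
    (hU : IsOpen U) {x : M} (hx : x ∈ U) :
    MDifferentiableAt (𝓡 D) (𝓡 D).tangent
      (fun x => (⟨x, X x⟩ : TangentBundle (𝓡 D) M)) x :=
  (hX.contMDiffAt hU hx).mdifferentiableAt (by simp)

lemma IsSmoothVFieldOn.bracket {X Z : VField D M} (hU : IsOpen U) (hX : IsSmoothVFieldOn X U)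
    (hZ : IsSmoothVFieldOn Z U) : IsSmoothVFieldOn (bracket X Z) U := by
  intro x hx
  have : IsManifold (𝓡 D) (minSmoothness ℝ 2) M := by
    refine IsManifold.of_le (n := ∞) ?_
    simp only [minSmoothness_of_isRCLikeNormedField]
    exact WithTop.coe_le_coe.2 (le_top : (2 : ℕ∞) ≤ ⊤)
  have : IsManifold (𝓡 D) (((⊤ : ℕ∞) : WithTop ℕ∞) + 1) M := by
    simpa using (inferInstance : IsManifold (𝓡 D) ∞ M)
  exact (ContMDiffAt.mlieBracket_vectorField (m := ⊤) (n := ⊤) (hX.contMDiffAt hU hx)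
    (hZ.contMDiffAt hU hx) (by simp)).contMDiffWithinAt

lemma IsSmoothVFieldOn.smul {X : VField D M} {f : M → ℝ}
    (hf : ContMDiffOn (𝓡 D) 𝓘(ℝ, ℝ) ∞ f U) (hX : IsSmoothVFieldOn X U) :
    IsSmoothVFieldOn (f • X) U :=
  ContMDiffOn.smul_section hf hX

lemma bracket_smul_right (hU : IsOpen U) {X Z : VField D M} {f : M → ℝ}
    (hf : ContMDiffOn (𝓡 D) 𝓘(ℝ, ℝ) ∞ f U) (hZ : IsSmoothVFieldOn Z U) {x : M} (hx : x ∈ U) :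
    bracket X (f • Z) x = dirDeriv X f x • Z x + f x • bracket X Z x :=
  VectorField.mlieBracket_smul_right (mdifferentiableAt_of_contMDiffOn hU hf hx)
    (hZ.mdifferentiableAt hU hx)

lemma bracket_add_right (hU : IsOpen U) {X Z Z' : VField D M}
    (hZ : IsSmoothVFieldOn Z U) (hZ' : IsSmoothVFieldOn Z' U) {x : M} (hx : x ∈ U) :
    bracket X (Z + Z') x = bracket X Z x + bracket X Z' x := by
  have : IsManifold (𝓡 D) 1 M := IsManifold.of_le (n := ∞) (by simp)
  exact VectorField.mlieBracket_add_right (hZ.mdifferentiableAt hU hx)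
    (hZ'.mdifferentiableAt hU hx)

lemma bracket_sum_right {ι : Type*} (s : Finset ι) (hU : IsOpen U) {X : VField D M}
    {Z : ι → VField D M} (hZ : ∀ i, IsSmoothVFieldOn (Z i) U) {x : M} (hx : x ∈ U) :
    bracket X (∑ i ∈ s, Z i) x = ∑ i ∈ s, bracket X (Z i) x := by
  classical
  induction s using Finset.induction_on with
  | empty =>
    have : IsManifold (𝓡 D) 1 M := IsManifold.of_le (n := ∞) (by simp)
    simp [bracket]
  | insert i s hi ih =>
    rw [Finset.sum_insert hi, Finset.sum_insert hi, ← ih]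
    refine bracket_add_right hU (hZ i) ?_ hx
    have := ContMDiffOn.sum_section (u := U) (s := s) (t := fun i => Z i) fun i _ => hZ i
    simpa [IsSmoothVFieldOn, Finset.sum_apply] using this

lemma bracket_jacobi (hU : IsOpen U) {X Z W : VField D M} (hX : IsSmoothVFieldOn X U)
    (hZ : IsSmoothVFieldOn Z U) (hW : IsSmoothVFieldOn W U) {x : M} (hx : x ∈ U) :
    bracket X (bracket Z W) x = bracket (bracket X Z) W x + bracket Z (bracket X W) x := by
  have : IsManifold (𝓡 D) (minSmoothness ℝ 3) M := by
    refine IsManifold.of_le (n := ∞) ?_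
    simp only [minSmoothness_of_isRCLikeNormedField]
    exact WithTop.coe_le_coe.2 (le_top : (3 : ℕ∞) ≤ ⊤)
  have h2 : minSmoothness ℝ 2 ≤ (∞ : WithTop ℕ∞) := by
    simp only [minSmoothness_of_isRCLikeNormedField]
    exact WithTop.coe_le_coe.2 (le_top : (2 : ℕ∞) ≤ ⊤)
  exact VectorField.leibniz_identity_mlieBracket_apply ((hX.contMDiffAt hU hx).of_le h2)
    ((hZ.contMDiffAt hU hx).of_le h2) ((hW.contMDiffAt hU hx).of_le h2)

/-- Expand the Jacobi identity for `X`, `Z`, `f • W` by the Leibniz rule. The terms with one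
derivative of `f` along `X` or `Z` cancel, those with `f` undifferentiated cancel by Jacobi for `X`,
`Z`, `W`, and what remains is the claim multiplied by `W x`. Hence the auxiliary nonvanishing field.
-/
lemma dirDeriv_bracket_real (hU : IsOpen U) {X Z W : VField D M} (hX : IsSmoothVFieldOn X U)
    (hZ : IsSmoothVFieldOn Z U) (hW : IsSmoothVFieldOn W U) {f : M → ℝ}
    (hf : ContMDiffOn (𝓡 D) 𝓘(ℝ, ℝ) ∞ f U) {x : M} (hx : x ∈ U) (hWx : W x ≠ 0) :
    dirDeriv (bracket X Z) f x = dirDeriv X (dirDeriv Z f) x - dirDeriv Z (dirDeriv X f) x := by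
  have key : ∀ {X Z : VField D M}, IsSmoothVFieldOn X U → IsSmoothVFieldOn Z U →
      bracket X (bracket Z (f • W)) x =
        dirDeriv X (dirDeriv Z f) x • W x + dirDeriv Z f x • bracket X W x
          + (dirDeriv X f x • bracket Z W x + f x • bracket X (bracket Z W) x) := by
    intro X Z hX hZ
    rw [bracket_congr_right hU (Z' := dirDeriv Z f • W + f • bracket Z W)
      (fun y hy => bracket_smul_right hU hf hW hy) hx,
      bracket_add_right hU (hW.smul (contMDiffOn_dirDeriv hU hZ hf)) ((hZ.bracket hU hW).smul hf) hx,
      bracket_smul_right hU (contMDiffOn_dirDeriv hU hZ hf) hW hx,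
      bracket_smul_right hU hf (hZ.bracket hU hW) hx]
  have h1 := bracket_jacobi hU hX hZ (hW.smul hf) hx
  rw [key hX hZ, key hZ hX, bracket_smul_right hU hf hW hx, bracket_jacobi hU hX hZ hW hx] at h1
  have h2 : (dirDeriv (bracket X Z) f x
      - (dirDeriv X (dirDeriv Z f) x - dirDeriv Z (dirDeriv X f) x)) • W x = 0 := by
    linear_combination (norm := module) -h1
  rcases smul_eq_zero.1 h2 with h | h
  · linarith
  · exact absurd h hWx

lemma dirDeriv_bracket (hU : IsOpen U) {X Z W : VField D M} (hX : IsSmoothVFieldOn X U)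
    (hZ : IsSmoothVFieldOn Z U) (hW : IsSmoothVFieldOn W U) {f : M → V}
    (hf : ContMDiffOn (𝓡 D) 𝓘(ℝ, V) ∞ f U) {x : M} (hx : x ∈ U) (hWx : W x ≠ 0) :
    dirDeriv (bracket X Z) f x = dirDeriv X (dirDeriv Z f) x - dirDeriv Z (dirDeriv X f) x := by
  by_contra hne
  -- Continuous linear functionals separate points, so the scalar case suffices.
  obtain ⟨l, hl⟩ := SeparatingDual.exists_separating_of_ne (R := ℝ) hne
  apply hl
  have hlf : ContMDiffOn (𝓡 D) 𝓘(ℝ, ℝ) ∞ (fun y => l (f y)) U :=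
    l.contMDiff.comp_contMDiffOn hf
  rw [map_sub, ← dirDeriv_clm hU l (contMDiffOn_dirDeriv hU hZ hf) hx,
    ← dirDeriv_clm hU l (contMDiffOn_dirDeriv hU hX hf) hx, ← dirDeriv_clm hU l hf hx,
    dirDeriv_bracket_real hU hX hZ hW hlf hx hWx]
  congr 1 <;> exact dirDeriv_congr hU (fun y hy => dirDeriv_clm hU l hf hy) hx

end Geometry

/-! ### Totally antisymmetric arrays of components. -/

section Alternating

variable {D k : ℕ}

/-- Total antisymmetry of an array of components. -/
def IsAlternating (Y : (Fin k → Fin D) → ℝ) : Prop :=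
  ∀ (s : Equiv.Perm (Fin k)) (b : Fin k → Fin D), Y (b ∘ s) = ((Equiv.Perm.sign s : ℤ) : ℝ) * Y b

lemma sign_mul_self_real (s : Equiv.Perm (Fin k)) :
    ((Equiv.Perm.sign s : ℤ) : ℝ) * ((Equiv.Perm.sign s : ℤ) : ℝ) = 1 := by
  rcases Int.units_eq_one_or (Equiv.Perm.sign s) with h | h <;> simp [h]

lemma isAlternating_antisymm (T : (Fin k → Fin D) → ℝ) : IsAlternating (antisymm T) := by
  intro s b
  simp only [antisymm, smul_eq_mul]
  rw [mul_left_comm]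
  congr 1
  rw [Finset.mul_sum]
  refine Fintype.sum_equiv (Equiv.mulLeft s) _ _ fun u => ?_
  simp only [Equiv.coe_mulLeft, Equiv.Perm.sign_mul, Units.val_mul, Int.cast_mul,
    Equiv.Perm.coe_mul, Function.comp_assoc]
  rw [← mul_assoc, ← mul_assoc, sign_mul_self_real, one_mul]

lemma IsAlternating.cons {Y : (Fin (k + 1) → Fin D) → ℝ} (hY : IsAlternating Y) (a : Fin D) :
    IsAlternating fun b : Fin k → Fin D => Y (Fin.cons a b) := by
  intro s b
  -- This permutation fixes `0`, acts as `s` on the successors, and has the sign of `s`.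
  have h := hY (Equiv.Perm.decomposeFin.symm (0, s)) (Fin.cons a b)
  have e : (Fin.cons a b : Fin (k + 1) → Fin D) ∘ (Equiv.Perm.decomposeFin.symm (0, s))
      = Fin.cons a (b ∘ s) := by
    funext i
    refine Fin.cases ?_ (fun j => ?_) i <;> simp
  simpa [e] using h

lemma IsAlternating.cons_cons {Y : (Fin (k + 2) → Fin D) → ℝ} (hY : IsAlternating Y)
    (a c : Fin D) (b : Fin k → Fin D) :
    Y (Fin.cons a (Fin.cons c b)) = -Y (Fin.cons c (Fin.cons a b)) := by
  have h := hY (Equiv.swap 0 1) (Fin.cons c (Fin.cons a b))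
  have e : (Fin.cons c (Fin.cons a b) : Fin (k + 2) → Fin D) ∘ (Equiv.swap 0 1)
      = Fin.cons a (Fin.cons c b) := by
    funext i
    refine Fin.cases ?_ (fun j => Fin.cases ?_ (fun l => ?_) j) i
    · simp
    · have : (Fin.succ 0 : Fin (k + 2)) = 1 := rfl
      simp [this]
    · have h0 : (l.succ.succ : Fin (k + 2)) ≠ 0 := Fin.succ_ne_zero _
      have h1 : (l.succ.succ : Fin (k + 2)) ≠ 1 := fun h =>
        Fin.succ_ne_zero l (Fin.succ_injective _ h)
      simp [Equiv.swap_apply_of_ne_of_ne h0 h1]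
  have h01 : (0 : Fin (k + 2)) ≠ 1 := by simp
  rw [e, Equiv.Perm.sign_swap h01] at h
  simpa using h

lemma isAlternating_alternatingMap {W : Type*} [AddCommGroup W] [Module ℝ W]
    (Y : W [⋀^Fin k]→ₗ[ℝ] ℝ) (E : Fin D → W) :
    IsAlternating fun b : Fin k → Fin D => Y fun l => E (b l) := by
  intro s b
  have := Y.map_perm (fun l => E (b l)) s
  simp only [Function.comp_def] at this ⊢
  rw [this]
  rcases Int.units_eq_one_or (Equiv.Perm.sign s) with h | h <;> simp [h]

end Alternating

/-! ### Clifford multiplication by a tensor and its commutators. -/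

section Slash

variable {D : ℕ} {B : Type*} [Ring B] [Algebra ℝ B] (γ : Fin D → B)

/-- Contraction of an array of components with products of gamma matrices. -/
def slash {k : ℕ} (Y : (Fin k → Fin D) → ℝ) : B :=
  ∑ b : Fin k → Fin D, Y b • (List.ofFn fun l => γ (b l)).prod

lemma slash_zero (Y : (Fin 0 → Fin D) → ℝ) : slash γ Y = Y Fin.elim0 • (1 : B) := by
  rw [slash, Fintype.sum_unique]
  simp
  congr

lemma sum_fin_succ {k : ℕ} {V : Type*} [AddCommMonoid V] (f : (Fin (k + 1) → Fin D) → V) :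
    ∑ b, f b = ∑ a, ∑ b : Fin k → Fin D, f (Fin.cons a b) := by
  rw [← Fintype.sum_prod_type']
  exact (Fintype.sum_equiv (Fin.consEquiv fun _ => Fin D) _ _ fun _ => rfl).symm

lemma slash_succ {k : ℕ} (Y : (Fin (k + 1) → Fin D) → ℝ) :
    slash γ Y = ∑ a, γ a * slash γ fun b : Fin k → Fin D => Y (Fin.cons a b) := by
  simp only [slash, sum_fin_succ, Finset.mul_sum, List.ofFn_succ, List.prod_cons, Fin.cons_zero,
    Fin.cons_succ, mul_smul_comm]

lemma slash_add {k : ℕ} (Y Z : (Fin k → Fin D) → ℝ) :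
    slash γ (fun b => Y b + Z b) = slash γ Y + slash γ Z := by
  simp only [slash, add_smul, Finset.sum_add_distrib]

lemma slash_smul {k : ℕ} (c : ℝ) (Y : (Fin k → Fin D) → ℝ) :
    slash γ (fun b => c * Y b) = c • slash γ Y := by
  simp only [slash, mul_smul, Finset.smul_sum]

lemma slash_neg {k : ℕ} (Y : (Fin k → Fin D) → ℝ) :
    slash γ (fun b => -Y b) = -slash γ Y := by
  simp only [slash, neg_smul, Finset.sum_neg_distrib]

lemma slash_sum {k : ℕ} {ι : Type*} (s : Finset ι) (Y : ι → (Fin k → Fin D) → ℝ) :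
    slash γ (fun b => ∑ i ∈ s, Y i b) = ∑ i ∈ s, slash γ (Y i) := by
  simp only [slash, Finset.sum_smul]
  exact Finset.sum_comm

/-- Relabelling the summed indices by `s` undoes the permutation of the gammas, and alternation of
`Y` absorbs its sign; the `k!` equal terms cancel the normalization. -/
lemma sum_smul_antisymm_eq_slash {k : ℕ} {Y : (Fin k → Fin D) → ℝ} (hY : IsAlternating Y) :
    ∑ b, Y b • antisymm (fun a : Fin k → Fin D => (List.ofFn fun l => γ (a l)).prod) b
      = slash γ Y := by
  simp only [antisymm]
  have h : ∀ s : Equiv.Perm (Fin k), ∑ b : Fin k → Fin D, Y b • ((Equiv.Perm.sign s : ℤ) : ℝ) •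
      (List.ofFn fun l => γ ((b ∘ s) l)).prod = slash γ Y := by
    intro s
    refine Fintype.sum_equiv (Equiv.arrowCongr s.symm (Equiv.refl _)) _ _ fun b => ?_
    have e : (Equiv.arrowCongr s.symm (Equiv.refl (Fin D))) b = b ∘ s := rfl
    rw [e, hY s b, smul_smul, mul_comm]
  simp only [smul_comm (Y _) ((k.factorial : ℝ)⁻¹), Finset.smul_sum]
  rw [Finset.sum_comm]
  simp only [← Finset.smul_sum]
  rw [Finset.sum_congr rfl fun s _ => h s, Finset.sum_const, Finset.card_univ, Fintype.card_perm, Fintype.card_fin,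
    ← Nat.cast_smul_eq_nsmul ℝ, smul_smul, inv_mul_cancel₀ (by positivity), one_smul]

/-- The Clifford relations `γ_a γ_b + γ_b γ_a = 2 η_a δ_{ab}`. -/
def IsClifford (η : Fin D → ℝ) : Prop :=
  ∀ a b, γ a * γ b + γ b * γ a = (if a = b then 2 * η a else 0 : ℝ) • (1 : B)

variable {γ} {η : Fin D → ℝ}

/-- Each gamma matrix that `γ c` passes contributes a sign and a contraction with weight `2 η c`;
alternation of `Y` makes the `k + 1` contractions equal. -/
lemma gamma_mul_slash (hγ : IsClifford γ η) (c : Fin D) {k : ℕ} {Y : (Fin (k + 1) → Fin D) → ℝ}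
    (hY : IsAlternating Y) :
    γ c * slash γ Y = (-1 : ℝ) ^ (k + 1) • (slash γ Y * γ c)
      + (2 * (k + 1 : ℝ) * η c) • slash γ fun b : Fin k → Fin D => Y (Fin.cons c b) := by
  have swap : ∀ (Z : Fin D → B), γ c * ∑ a, γ a * Z a
      = (2 * η c) • Z c - ∑ a, γ a * (γ c * Z a) := by
    intro Z
    have h : ∀ a, γ c * (γ a * Z a)
        = (if c = a then 2 * η c else 0 : ℝ) • Z a - γ a * (γ c * Z a) := by
      intro a
      rw [← mul_assoc, eq_sub_iff_add_eq, ← mul_assoc, ← add_mul, hγ, smul_mul_assoc, one_mul]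
    simp only [Finset.mul_sum, h, Finset.sum_sub_distrib, ite_smul, zero_smul]
    simp
  induction k with
  | zero =>
    rw [slash_succ, swap]
    simp only [slash_zero, mul_smul_comm, smul_mul_assoc, mul_one, Finset.sum_mul]
    simp [sub_eq_neg_add]
  | succ k ih =>
    rw [slash_succ, swap]
    have h : ∀ a, γ a * (γ c * slash γ fun b : Fin (k + 1) → Fin D => Y (Fin.cons a b))
        = (-1 : ℝ) ^ (k + 1) • ((γ a * slash γ fun b : Fin (k + 1) → Fin D => Y (Fin.cons a b)) * γ c)
          - (2 * (k + 1 : ℝ) * η c) •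
            (γ a * slash γ fun b : Fin k → Fin D => Y (Fin.cons c (Fin.cons a b))) := by
      intro a
      rw [ih (hY.cons a)]
      have : (fun b : Fin k → Fin D => Y (Fin.cons a (Fin.cons c b)))
        = fun b => - Y (Fin.cons c (Fin.cons a b)) := funext fun b => hY.cons_cons a c b
      rw [this, slash_neg]
      simp only [mul_add, mul_smul_comm, mul_assoc, mul_neg, smul_neg, sub_eq_add_neg]
    simp only [h, Finset.sum_sub_distrib, ← Finset.smul_sum, ← Finset.sum_mul]
    rw [← slash_succ γ Y, ← slash_succ γ fun b => Y (Fin.cons c b)]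
    push_cast
    rw [pow_succ (-1 : ℝ) (k + 1)]
    module

/-- The derivation of covariant tensors by the matrix `m`. -/
def derivAction (m : Fin D → Fin D → ℝ) {k : ℕ} (Y : (Fin k → Fin D) → ℝ) (b : Fin k → Fin D) : ℝ :=
  ∑ i, ∑ l, m l (b i) * Y (Function.update b i l)

/-- A commutator is a derivation, so it acts on one factor at a time; `Y` needs no symmetry. -/
lemma commutator_slash {R : B} {m : Fin D → Fin D → ℝ}
    (hR : ∀ l, R * γ l - γ l * R = ∑ j, m l j • γ j) {k : ℕ} (Y : (Fin k → Fin D) → ℝ) :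
    R * slash γ Y - slash γ Y * R = slash γ (derivAction m Y) := by
  induction k with
  | zero => simp [slash_zero, derivAction]
  | succ k ih =>
    have h1 : ∀ (j : Fin D), (fun b : Fin k → Fin D => derivAction m Y (Fin.cons j b))
        = fun b => (∑ l, m l j * Y (Fin.cons l b))
          + derivAction m (fun b' => Y (Fin.cons j b')) b := by
      intro j
      funext b
      simp only [derivAction, Fin.sum_univ_succ, Fin.cons_zero, Fin.cons_succ, Fin.update_cons_zero,
        ← Fin.cons_update]
    rw [slash_succ γ (derivAction m Y)]
    simp only [h1, slash_add, slash_sum, slash_smul, ← ih]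
    rw [slash_succ γ Y]
    have h2 : ∀ (a : Fin D) (S : B), R * (γ a * S) = γ a * (R * S) + ∑ j, m a j • (γ j * S) := by
      intro a S
      have : R * γ a = γ a * R + ∑ j, m a j • γ j := by rw [← hR a]; abel
      rw [← mul_assoc, this, add_mul, Finset.sum_mul, mul_assoc]
      simp only [smul_mul_assoc]
    simp only [Finset.mul_sum, Finset.sum_mul, h2, mul_add, mul_sub, Finset.sum_add_distrib,
      Finset.sum_sub_distrib, mul_assoc, mul_smul_comm]
    rw [Finset.sum_comm (f := fun a j => m a j • (γ j * slash γ fun b => Y (Fin.cons a b)))]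
    abel

/-- Quadratic elements act on vectors as infinitesimal rotations. The factor `4` is what the `1/4`
of the spin connection compensates. -/
lemma commutator_quadratic_gamma (hγ : IsClifford γ η) {w : Fin D → Fin D → ℝ}
    (hw : ∀ j k, w j k = -w k j) (l : Fin D) :
    (∑ j, ∑ k, w j k • (γ j * γ k)) * γ l - γ l * (∑ j, ∑ k, w j k • (γ j * γ k))
      = ∑ j, (-4 * η l * w l j) • γ j := by
  have h : ∀ j k, γ j * γ k * γ l - γ l * (γ j * γ k)
      = (if k = l then 2 * η l else 0 : ℝ) • γ j - (if j = l then 2 * η l else 0 : ℝ) • γ k := by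
    intro j k
    have e1 : γ j * (γ k * γ l + γ l * γ k) = (if k = l then 2 * η l else 0 : ℝ) • γ j := by
      rw [hγ k l]
      split_ifs with hkl <;> simp [hkl]
    have e2 : (γ j * γ l + γ l * γ j) * γ k = (if j = l then 2 * η l else 0 : ℝ) • γ k := by
      rw [hγ j l]
      split_ifs with hkl <;> simp [hkl]
    rw [← e1, ← e2]
    noncomm_ring
  simp only [Finset.sum_mul, Finset.mul_sum, smul_mul_assoc, mul_smul_comm,
    ← Finset.sum_sub_distrib, ← smul_sub, h]
  simp only [smul_sub, Finset.sum_sub_distrib, ite_smul, zero_smul, smul_ite, smul_zero,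
    Finset.sum_ite_eq', Finset.mem_univ, if_true]
  rw [Finset.sum_comm (f := fun j k => if j = l then w j k • (2 * η l) • γ k else 0)]
  simp only [Finset.sum_ite_eq', Finset.mem_univ, if_true, ← Finset.sum_sub_distrib]
  refine Finset.sum_congr rfl fun j _ => ?_
  rw [hw j l]
  module

end Slash

/-! ### Contractions of a totally antisymmetric tensor with gamma matrices. -/

section Contraction

variable {D : ℕ} {B : Type*} [Ring B] [Algebra ℝ B] {γ : Fin D → B} {η : Fin D → ℝ}

/-- Applied to `T = ∇Y`, this recovers every `∇_c Y` from the Dirac derivative of `Y`. -/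
lemma graded_commutator_slash (hγ : IsClifford γ η) (c : Fin D) {k : ℕ}
    {T : (Fin (k + 1) → Fin D) → ℝ} (hT : IsAlternating T) :
    γ c * slash γ T + (-1 : ℝ) ^ k • (slash γ T * γ c)
      = (2 * (k + 1 : ℝ) * η c) • slash γ fun b : Fin k → Fin D => T (Fin.cons c b) := by
  rw [gamma_mul_slash hγ c hT, pow_succ]
  module

/-- The contraction repeats the index `a` and vanishes, so `γ a` moves through the remaining `k + 1`
slots at the cost of a sign only. -/
lemma sum_slash_mul_gamma (hγ : IsClifford γ η) {k : ℕ}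
    {T : (Fin (k + 2) → Fin D) → ℝ} (hT : IsAlternating T) :
    ∑ a, slash γ (fun b : Fin (k + 1) → Fin D => T (Fin.cons a b)) * γ a
      = (-1 : ℝ) ^ (k + 1) • slash γ T := by
  rw [slash_succ γ T, Finset.smul_sum]
  refine Finset.sum_congr rfl fun a _ => ?_
  have hz : (fun b : Fin k → Fin D => T (Fin.cons a (Fin.cons a b))) = fun _ => 0 * 0 := by
    funext b
    have := hT.cons_cons a a b
    linarith
  rw [gamma_mul_slash hγ a (hT.cons a), hz, slash_smul, zero_smul, smul_zero, add_zero, smul_smul,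
    ← mul_pow]
  simp

end Contraction

/-! ### Clifford identities for a Riemann tensor. -/

section Curvature

variable {D : ℕ}

/-- The algebraic symmetries of a Riemann tensor. -/
structure IsRiemannTensor (R : Fin D → Fin D → Fin D → Fin D → ℝ) : Prop where
  antisymm_left : ∀ a b j k, R a b j k = -R b a j k
  antisymm_right : ∀ a b j k, R a b j k = -R a b k j
  bianchi : ∀ a b k j, R a b j k + R b k j a + R k a j b = 0

lemma IsRiemannTensor.pair_symm {R : Fin D → Fin D → Fin D → Fin D → ℝ} (hR : IsRiemannTensor R)
    (a b j k : Fin D) : R a b j k = R j k a b := by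
  have l := hR.antisymm_left
  have r := hR.antisymm_right
  have b1 := hR.bianchi a b k j
  have b2 := hR.bianchi a b j k
  have b3 := hR.bianchi j k a b
  have b4 := hR.bianchi j k b a
  linarith [r a b k j, r b j k a, l b j a k, l j a b k, r j a k b, r k a j b, l k a b j, r b k j a,
    l b k a j, r j k b a, l k b a j, r k b a j, r a j b k, r b j a k, r a k b j, r k a b j,
    l a k b j, l a k j b, l a j b k, l a j k b, r b k a j, r j b a k, r j a b k, l j b a k,
    l k j a b, l j k a b]

/-- The Ricci contraction. -/
def ricci (η : Fin D → ℝ) (R : Fin D → Fin D → Fin D → Fin D → ℝ) (a k : Fin D) : ℝ :=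
  ∑ c, η c * R a c c k

lemma IsRiemannTensor.ricci_symm {R : Fin D → Fin D → Fin D → Fin D → ℝ} (hR : IsRiemannTensor R)
    (η : Fin D → ℝ) (a k : Fin D) : ricci η R a k = ricci η R k a := by
  refine Finset.sum_congr rfl fun c _ => ?_
  rw [hR.pair_symm, hR.antisymm_left, hR.antisymm_right, neg_neg]

variable {B : Type*} [Ring B] [Algebra ℝ B] {γ : Fin D → B} {η : Fin D → ℝ}

/-- The Clifford algebra element `∑ R_{abjk} γ^j γ^k`. -/
def curvatureGamma (γ : Fin D → B) (R : Fin D → Fin D → Fin D → Fin D → ℝ) (a b : Fin D) : B :=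
  ∑ j, ∑ k, R a b j k • (γ j * γ k)

lemma sum_curvatureGamma_mul_gamma (hγ : IsClifford γ η)
    {R : Fin D → Fin D → Fin D → Fin D → ℝ} (hR : IsRiemannTensor R) (a : Fin D) :
    ∑ c, curvatureGamma γ R a c * γ c
      = ∑ c, γ c * curvatureGamma γ R a c - (4 : ℝ) • ∑ k, ricci η R a k • γ k := by
  have h : ∀ c, curvatureGamma γ R a c * γ c
      = γ c * curvatureGamma γ R a c + ∑ j, (-4 * η c * R a c c j) • γ j := fun c => by
    rw [← commutator_quadratic_gamma hγ (hR.antisymm_right a c), curvatureGamma]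
    abel
  simp only [h, Finset.sum_add_distrib]
  rw [Finset.sum_comm, sub_eq_add_neg]
  congr 1
  simp only [ricci, Finset.smul_sum, Finset.sum_smul, ← Finset.sum_neg_distrib]
  refine Finset.sum_congr rfl fun j _ => Finset.sum_congr rfl fun c _ => ?_
  module

/-- With `X` the left side and `ρ` the Ricci sum, the three cyclic arrangements of the last three
indices of `R`, against the same product of gammas, reorder to `X`, `X - 4ρ` and `X - 2ρ`. They add
to zero by Bianchi, so `3 (X - 2ρ) = 0`. -/
lemma sum_gamma_mul_curvatureGamma (hγ : IsClifford γ η)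
    {R : Fin D → Fin D → Fin D → Fin D → ℝ} (hR : IsRiemannTensor R) (a : Fin D) :
    ∑ c, γ c * curvatureGamma γ R a c = (2 : ℝ) • ∑ k, ricci η R a k • γ k := by
  set X := ∑ c, γ c * curvatureGamma γ R a c with hX
  set ρ := ∑ k, ricci η R a k • γ k with hρ
  have e1 := sum_curvatureGamma_mul_gamma hγ hR a
  have x1 : X = ∑ c, ∑ j, ∑ k, R a c j k • (γ c * γ j * γ k) := by
    simp only [hX, curvatureGamma, Finset.mul_sum, mul_smul_comm, mul_assoc]
  have x2 : ∑ c, curvatureGamma γ R a c * γ c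
      = ∑ c, ∑ j, ∑ k, R a k c j • (γ c * γ j * γ k) := by
    simp only [curvatureGamma, Finset.sum_mul, smul_mul_assoc]
    rw [Finset.sum_comm]
    exact Finset.sum_congr rfl fun j _ => Finset.sum_comm
  have x3 : ∑ c, ∑ j, ∑ k, R a j k c • (γ c * γ j * γ k) = X - (2 : ℝ) • ρ := by
    have h : ∀ c j k, R a j k c • (γ c * γ j * γ k)
        = R a j c k • (γ j * γ c * γ k) - (if c = j then 2 * η c * R a j c k else 0 : ℝ) • γ k := by
      intro c j k
      have := congrArg (fun z => R a j c k • (z * γ k)) (hγ c j)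
      simp only [add_mul, smul_add, smul_mul_assoc, one_mul] at this
      rw [hR.antisymm_right a j k c, neg_smul, neg_eq_iff_add_eq_zero, add_sub_assoc', this]
      split_ifs <;> module
    simp only [h, Finset.sum_sub_distrib]
    congr 1
    · rw [x1, Finset.sum_comm]
    · have h1 : ∀ c, ∑ j, ∑ k, (if c = j then 2 * η c * R a j c k else 0 : ℝ) • γ k
          = ∑ k, (2 * η c * R a c c k) • γ k := fun c => by
        rw [Finset.sum_eq_single c (fun j _ hj => by simp [Ne.symm hj]) (by simp)]
        simp
      simp only [h1, hρ, ricci, Finset.smul_sum, Finset.sum_smul, smul_smul]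
      rw [Finset.sum_comm]
      exact Finset.sum_congr rfl fun k _ => Finset.sum_congr rfl fun c _ => by rw [mul_assoc]
  have x0 : ∑ c, ∑ j, ∑ k, R a c j k • (γ c * γ j * γ k)
      + ∑ c, ∑ j, ∑ k, R a k c j • (γ c * γ j * γ k)
      + ∑ c, ∑ j, ∑ k, R a j k c • (γ c * γ j * γ k) = 0 := by
    simp only [← Finset.sum_add_distrib, ← add_smul]
    refine Finset.sum_eq_zero fun c _ => Finset.sum_eq_zero fun j _ => Finset.sum_eq_zero
      fun k _ => ?_
    have h : R a c j k + R a k c j + R a j k c = 0 := by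
      have h1 := hR.bianchi j k c a
      rw [hR.pair_symm j k, hR.pair_symm k c, hR.pair_symm c j] at h1
      linarith
    rw [h, zero_smul]
  rw [← x1, ← x2, x3, e1] at x0
  have : (3 : ℝ) • (X - (2 : ℝ) • ρ) = 0 := by
    rw [← x0]
    module
  exact sub_eq_zero.1 ((smul_eq_zero.1 this).resolve_left (by norm_num))

lemma sum_curvatureGamma_mul_gamma_left (hγ : IsClifford γ η)
    {R : Fin D → Fin D → Fin D → Fin D → ℝ} (hR : IsRiemannTensor R) (c : Fin D) :
    ∑ a, curvatureGamma γ R a c * γ a = (2 : ℝ) • ∑ k, ricci η R c k • γ k := by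
  have h : ∀ a, curvatureGamma γ R a c = -curvatureGamma γ R c a := fun a => by
    simp only [curvatureGamma, ← Finset.sum_neg_distrib, ← neg_smul]
    exact Finset.sum_congr rfl fun j _ => Finset.sum_congr rfl fun k _ => by
      rw [hR.antisymm_left]
  simp only [h, neg_mul, Finset.sum_neg_distrib, sum_curvatureGamma_mul_gamma hγ hR,
    sum_gamma_mul_curvatureGamma hγ hR]
  module

/-- The cost of exchanging two derivatives of `y` between gamma matrices. Both halves of the
commutator reduce to twice the Ricci tensor contracted with `γ y γ`, and they agree because Ricci is
symmetric. -/
lemma sum_gamma_commutator_curvatureGamma (hγ : IsClifford γ η)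
    {R : Fin D → Fin D → Fin D → Fin D → ℝ} (hR : IsRiemannTensor R) (y : B) :
    ∑ a, ∑ c, γ c * (curvatureGamma γ R a c * y - y * curvatureGamma γ R a c) * γ a = 0 := by
  have e1 : ∑ a, ∑ c, γ c * (curvatureGamma γ R a c * y) * γ a
      = ∑ a, ∑ k, (2 * ricci η R a k) • (γ k * y * γ a) := by
    refine Finset.sum_congr rfl fun a _ => ?_
    rw [← Finset.sum_mul]
    simp only [← mul_assoc]
    rw [← Finset.sum_mul, sum_gamma_mul_curvatureGamma hγ hR]
    simp only [Finset.smul_sum, Finset.sum_mul, smul_mul_assoc, smul_smul]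
  have e2 : ∑ a, ∑ c, γ c * (y * curvatureGamma γ R a c) * γ a
      = ∑ c, ∑ k, (2 * ricci η R c k) • (γ c * y * γ k) := by
    rw [Finset.sum_comm]
    refine Finset.sum_congr rfl fun c _ => ?_
    simp only [mul_assoc]
    rw [← Finset.mul_sum, ← Finset.mul_sum, sum_curvatureGamma_mul_gamma_left hγ hR]
    simp only [Finset.smul_sum, Finset.mul_sum, mul_smul_comm, smul_smul]
  simp only [mul_sub, sub_mul, Finset.sum_sub_distrib, e1, e2]
  rw [sub_eq_zero, Finset.sum_comm]
  exact Finset.sum_congr rfl fun j _ => Finset.sum_congr rfl fun k _ => by rw [hR.ricci_symm]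

/-- The Lichnerowicz computation: only the symmetric part of `γ^a γ^k` meets the Ricci tensor, which
leaves a scalar. -/
lemma sum_gamma_gamma_curvatureGamma (hγ : IsClifford γ η)
    {R : Fin D → Fin D → Fin D → Fin D → ℝ} (hR : IsRiemannTensor R) :
    ∑ a, ∑ c, γ a * γ c * curvatureGamma γ R a c = (2 * ∑ a, η a * ricci η R a a) • (1 : B) := by
  have e : ∑ a, ∑ c, γ a * γ c * curvatureGamma γ R a c
      = (2 : ℝ) • ∑ a, ∑ k, ricci η R a k • (γ a * γ k) := by
    rw [Finset.smul_sum]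
    refine Finset.sum_congr rfl fun a _ => ?_
    simp only [mul_assoc]
    rw [← Finset.mul_sum, sum_gamma_mul_curvatureGamma hγ hR]
    simp only [Finset.mul_sum, mul_smul_comm]
  have e' : ∑ a, ∑ k, ricci η R a k • (γ a * γ k) = ∑ a, ∑ k, ricci η R a k • (γ k * γ a) := by
    rw [Finset.sum_comm]
    exact Finset.sum_congr rfl fun j _ => Finset.sum_congr rfl fun k _ => by rw [hR.ricci_symm]
  rw [e, two_smul]
  nth_rw 2 [e']
  have hγ' : ∀ a k, γ a * γ k + γ k * γ a = (if a = k then 2 * η a else 0 : ℝ) • (1 : B) := hγ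
  simp only [← Finset.sum_add_distrib, ← smul_add, hγ', smul_smul]
  simp only [mul_ite, mul_zero, ite_smul, zero_smul, Finset.sum_ite_eq, Finset.mem_univ, if_true,
    Finset.mul_sum, Finset.sum_smul]
  exact Finset.sum_congr rfl fun a _ => by congr 1; ring

end Curvature

/-! ### The condition on `F` and `Y` as a vanishing derivation. -/

section Lift

variable {D : ℕ}

/-- Each index is the image of `0` under exactly `n!` permutations. -/
lemma sum_perm_apply_zero {n : ℕ} (G : Fin (n + 1) → ℝ) :
    ∑ s : Equiv.Perm (Fin (n + 1)), G (s 0) = (n.factorial : ℝ) * ∑ i, G i := by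
  have h : ∀ i, ∑ s : Equiv.Perm (Fin (n + 1)), G (s i)
      = ∑ s : Equiv.Perm (Fin (n + 1)), G (s 0) := fun i =>
    Fintype.sum_equiv (Equiv.mulRight (Equiv.swap 0 i)) _ _ fun s => by simp
  have h2 : ∑ i, ∑ s : Equiv.Perm (Fin (n + 1)), G (s i)
      = ((n + 1).factorial : ℝ) * ∑ i, G i := by
    rw [Finset.sum_comm]
    simp [Equiv.sum_comp, Fintype.card_perm]
  simp only [h, Finset.sum_const, Finset.card_univ, Fintype.card_fin, nsmul_eq_mul] at h2
  rw [Nat.factorial_succ, Nat.cast_mul, mul_assoc] at h2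
  exact mul_left_cancel₀ (by positivity) h2

/-- Alternation of `Y` undoes the permutation, so each term depends on `s` only through `s 0`, the
slot being replaced. The antisymmetrization is thus a nonzero multiple of the derivation; rotating
`b` from the last slot to the first gives `(-1)^n`. -/
lemma derivAction_eq_zero_of_antisymm {n : ℕ} (f : Fin D → Fin D → ℝ)
    {Y : (Fin (n + 1) → Fin D) → ℝ} (hY : IsAlternating Y) (a : Fin (n + 1) → Fin D)
    (h : antisymm (fun a' : Fin (n + 1) → Fin D =>
      ∑ b, f b (a' 0) * Y (Fin.snoc (fun k : Fin n => a' k.succ) b)) a = 0) :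
    derivAction f Y a = 0 := by
  have e : ∀ s : Equiv.Perm (Fin (n + 1)), ((Equiv.Perm.sign s : ℤ) : ℝ) •
      (∑ b, f b ((a ∘ s) 0) * Y (Fin.snoc (fun k : Fin n => (a ∘ s) k.succ) b))
      = (-1) ^ n * ∑ b, f b (a (s 0)) * Y (Function.update a (s 0) b) := by
    intro s
    have e1 : ∀ b, Y (Fin.snoc (fun k : Fin n => (a ∘ s) k.succ) b)
        = (-1) ^ n * (((Equiv.Perm.sign s : ℤ) : ℝ) * Y (Function.update a (s 0) b)) := by
      intro b
      rw [← hY s, Fin.snoc_eq_cons_rotate]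
      have h1 := hY (finRotate (n + 1)) (Fin.cons b fun k : Fin n => (a ∘ s) k.succ)
      rw [sign_finRotate] at h1
      have h2 : (Fin.cons b fun k : Fin n => (a ∘ s) k.succ : Fin (n + 1) → Fin D)
          = Function.update a (s 0) b ∘ s := by
        funext i
        refine Fin.cases ?_ (fun j => ?_) i
        · simp
        · simp
      rw [h2] at h1
      rw [← h2]
      rw [← h2] at h1
      simpa [Function.comp_def] using h1
    simp only [e1, smul_eq_mul, Finset.mul_sum]
    refine Finset.sum_congr rfl fun b _ => ?_
    simp only [Function.comp]
    linear_combination (-1) ^ n * f b (a (s 0)) * Y (Function.update a (s 0) b)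
      * sign_mul_self_real s
  simp only [antisymm] at h
  rw [Finset.sum_congr rfl fun s _ => e s, ← Finset.mul_sum,
    sum_perm_apply_zero fun i => ∑ b, f b (a i) * Y (Function.update a i b)] at h
  have hn : (n.factorial : ℝ) ≠ 0 := by positivity
  have hn' : ((n + 1).factorial : ℝ) ≠ 0 := by positivity
  simpa [hn, hn', derivAction] using h

variable {B : Type*} [Ring B] [Algebra ℝ B] {γ : Fin D → B} {η : Fin D → ℝ}

lemma commutator_quadratic_slash (hγ : IsClifford γ η) {w : Fin D → Fin D → ℝ}
    (hw : ∀ j k, w j k = -w k j) {k : ℕ} (Y : (Fin k → Fin D) → ℝ) :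
    (∑ i, ∑ j, w i j • (γ i * γ j)) * slash γ Y - slash γ Y * (∑ i, ∑ j, w i j • (γ i * γ j))
      = slash γ (derivAction (fun l j => -4 * η l * w l j) Y) :=
  commutator_slash (commutator_quadratic_gamma hγ hw) Y

end Lift

/-! ### The operator identity in an abstract ring. -/

section DiracAlgebra

variable {D : ℕ} {A : Type*} [Ring A] [Algebra ℝ A]

/-- A Dirac algebra: gamma matrices, covariant derivatives `N` and connection coefficients `w`
as elements of one ring, together with an element `y` commuting with the coefficients. -/
structure DiracAlgebra (γ N : Fin D → A) (η : Fin D → ℝ) (w : Fin D → Fin D → Fin D → A)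
    (y : A) : Prop where
  clifford : IsClifford γ η
  antisymm : ∀ a b c, w a b c = -w a c b
  comm_gamma : ∀ a b c d, w a b c * γ d = γ d * w a b c
  comm_y : ∀ a b c, w a b c * y = y * w a b c
  comm_dy : ∀ a b c d, w a b c * (N d * y - y * N d) = (N d * y - y * N d) * w a b c
  deriv_gamma : ∀ a b, N a * γ b - γ b * N a = -∑ c, η b • (w a b c * γ c)

variable {γ N : Fin D → A} {η : Fin D → ℝ} {w : Fin D → Fin D → Fin D → A} {y : A}

/-- The second covariant derivative. -/
def hess (N : Fin D → A) (η : Fin D → ℝ) (w : Fin D → Fin D → Fin D → A) (a c : Fin D) : A :=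
  N a * N c - ∑ m, η m • (w a m c * N m)

/-- The curvature of the covariant derivative. -/
def curv (N : Fin D → A) (η : Fin D → ℝ) (w : Fin D → Fin D → Fin D → A) (a c : Fin D) : A :=
  N a * N c - N c * N a - ∑ m, η m • ((w a m c - w c m a) * N m)

/-- The covariant derivative of `y`. -/
def dElt (N : Fin D → A) (y : A) (a : Fin D) : A := N a * y - y * N a

/-- The second covariant derivative of `y`. -/
def ddElt (N : Fin D → A) (η : Fin D → ℝ) (w : Fin D → Fin D → Fin D → A) (y : A)
    (a c : Fin D) : A :=
  N a * dElt N y c - dElt N y c * N a - ∑ m, η m • (w a m c * dElt N y m)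

/-- The left Dirac derivative of `y`. -/
def diracElt (γ N : Fin D → A) (y : A) : A := ∑ c, γ c * dElt N y c

lemma hess_sub_hess (a c : Fin D) : hess N η w a c - hess N η w c a = curv N η w a c := by
  simp only [hess, curv, sub_mul, smul_sub, Finset.sum_sub_distrib]
  abel

/-- Splits off the curvature of the bare frame derivatives `d`, which vanishes in the application
because there is no torsion. -/
lemma curv_add (d c : Fin D → A) (η : Fin D → ℝ) (w : Fin D → Fin D → Fin D → A) (a b : Fin D) :
    curv (fun i => d i + c i) η w a b
      = (d a * d b - d b * d a - ∑ m, η m • ((w a m b - w b m a) * d m))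
        + ((d a * c b - c b * d a) - (d b * c a - c a * d b) + (c a * c b - c b * c a)
          - ∑ m, η m • ((w a m b - w b m a) * c m)) := by
  simp only [curv, mul_add, add_mul, smul_add, Finset.sum_add_distrib]
  abel

/-- Used with `c = 2p` and `Z a` the contraction of `Y` with the frame index `a`; the last term on
the right comes from moving `N a` past `y`. -/
lemma sum_mul_N_of_smul_eq {Z : Fin D → A} {c ε : ℝ}
    (hZ : ∀ a, c • Z a = γ a * y - ε • (y * γ a)) :
    c • ∑ a, Z a * N a
      = (∑ a, γ a * N a) * y - ε • (y * ∑ a, γ a * N a) - diracElt γ N y := by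
  simp only [Finset.smul_sum, ← smul_mul_assoc, hZ, diracElt, dElt, Finset.sum_mul,
    Finset.mul_sum, ← Finset.sum_sub_distrib]
  refine Finset.sum_congr rfl fun a _ => ?_
  simp only [sub_mul, mul_sub, smul_mul_assoc, mul_assoc]
  abel

namespace DiracAlgebra

lemma N_mul_gamma (h : DiracAlgebra γ N η w y) (a b : Fin D) :
    N a * γ b = γ b * N a - ∑ c, η b • (w a b c * γ c) := by
  rw [sub_eq_add_neg, ← h.deriv_gamma]
  abel

lemma comm_dElt (h : DiracAlgebra γ N η w y) (a b c d : Fin D) :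
    w a b c * dElt N y d = dElt N y d * w a b c := h.comm_dy a b c d

lemma dirac_sq (h : DiracAlgebra γ N η w y) :
    (∑ a, γ a * N a) * ∑ a, γ a * N a = ∑ a, ∑ c, γ a * γ c * hess N η w a c := by
  rw [Finset.sum_mul]
  refine Finset.sum_congr rfl fun a _ => ?_
  have e : ∀ b, γ a * N a * (γ b * N b)
      = γ a * γ b * (N a * N b) - ∑ c, η b • (γ a * γ c * (w a b c * N b)) := by
    intro b
    rw [show γ a * N a * (γ b * N b) = γ a * (N a * γ b) * N b by noncomm_ring, h.N_mul_gamma]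
    simp only [mul_sub, sub_mul, Finset.mul_sum, Finset.sum_mul, mul_smul_comm, smul_mul_assoc,
      h.comm_gamma, mul_assoc]
  simp only [Finset.mul_sum, e, hess, mul_sub, Finset.sum_sub_distrib, mul_smul_comm]
  rw [Finset.sum_comm]

/-- The symmetric part of `γ^a γ^c` is the metric and yields the trace; the antisymmetric part sees
only the curvature. -/
lemma sum_gamma_hess (h : DiracAlgebra γ N η w y) :
    (2 : ℝ) • ∑ a, ∑ c, γ a * γ c * hess N η w a c
      = (2 : ℝ) • (∑ a, η a • hess N η w a a) + ∑ a, ∑ c, γ a * γ c * curv N η w a c := by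
  have e : ∑ a, ∑ c, γ a * γ c * hess N η w a c
      = ∑ a, ((2 * η a) • hess N η w a a) - ∑ a, ∑ c, γ a * γ c * hess N η w c a := by
    rw [eq_sub_iff_add_eq]
    nth_rw 2 [Finset.sum_comm]
    rw [← Finset.sum_add_distrib]
    refine Finset.sum_congr rfl fun a _ => ?_
    rw [← Finset.sum_add_distrib]
    simp only [← add_mul, fun c => h.clifford a c, ite_smul, zero_smul]
    simp
  rw [two_smul]
  nth_rw 1 [e]
  simp only [← hess_sub_hess, mul_sub, Finset.sum_sub_distrib, mul_smul, ← Finset.smul_sum]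
  abel

lemma hess_commutator (h : DiracAlgebra γ N η w y) (a c : Fin D) :
    hess N η w a c * y - y * hess N η w a c
      = ddElt N η w y a c + dElt N y c * N a + dElt N y a * N c := by
  have e : ∀ m, w a m c * N m * y = y * (w a m c * N m) + w a m c * dElt N y m := by
    intro m
    rw [← mul_assoc, ← h.comm_y, dElt]
    noncomm_ring
  simp only [hess, ddElt, sub_mul, mul_sub, Finset.sum_mul, Finset.mul_sum, smul_mul_assoc,
    mul_smul_comm, e, smul_add, Finset.sum_add_distrib]
  simp only [dElt]
  noncomm_ring

lemma ddElt_sub_ddElt (h : DiracAlgebra γ N η w y) (a c : Fin D) :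
    ddElt N η w y a c - ddElt N η w y c a = curv N η w a c * y - y * curv N η w a c := by
  have h1 := h.hess_commutator a c
  have h2 := h.hess_commutator c a
  rw [← hess_sub_hess, eq_sub_of_add_eq (eq_sub_of_add_eq h1.symm),
    eq_sub_of_add_eq (eq_sub_of_add_eq h2.symm)]
  noncomm_ring

/-- The gamma matrices are covariantly constant: the connection term from differentiating `γ c` is
the one that `ddElt` subtracts for its frame index. -/
lemma N_commutator_diracElt (h : DiracAlgebra γ N η w y) (a : Fin D) :
    N a * diracElt γ N y - diracElt γ N y * N a = ∑ c, γ c * ddElt N η w y a c := by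
  have e : ∀ c, N a * (γ c * dElt N y c) - γ c * dElt N y c * N a
      = γ c * (N a * dElt N y c - dElt N y c * N a)
        - ∑ m, η c • (γ m * (w a c m * dElt N y c)) := by
    intro c
    rw [← mul_assoc, h.N_mul_gamma, sub_mul, Finset.sum_mul]
    simp only [h.comm_gamma, smul_mul_assoc, mul_assoc, mul_sub]
    abel
  simp only [diracElt, Finset.mul_sum, Finset.sum_mul, ← Finset.sum_sub_distrib, e]
  simp only [Finset.sum_sub_distrib, ddElt, mul_sub, Finset.mul_sum, mul_smul_comm]
  rw [Finset.sum_comm]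

lemma sum_ddElt_mul_gamma (h : DiracAlgebra γ N η w y) (c : Fin D) :
    ∑ a, ddElt N η w y c a * γ a
      = N c * (∑ a, dElt N y a * γ a) - (∑ a, dElt N y a * γ a) * N c := by
  have e : ∀ a, N c * (dElt N y a * γ a) - dElt N y a * γ a * N c
      = (N c * dElt N y a - dElt N y a * N c) * γ a
        - ∑ m, η a • (w c a m * dElt N y a * γ m) := by
    intro a
    have := congrArg (dElt N y a * ·) (h.deriv_gamma c a)
    simp only [mul_sub, mul_neg, Finset.mul_sum, mul_smul_comm, ← mul_assoc] at this
    simp only [h.comm_dElt, sub_eq_add_neg _ (∑ m, _), ← this]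
    noncomm_ring
  simp only [Finset.mul_sum, Finset.sum_mul, ← Finset.sum_sub_distrib, e]
  simp only [Finset.sum_sub_distrib, ddElt, sub_mul, Finset.sum_mul, smul_mul_assoc]
  rw [Finset.sum_comm (f := fun a m => η m • (w c m a * dElt N y m * γ a))]

variable {ε r : ℝ}

lemma comm_diracElt (h : DiracAlgebra γ N η w y) (a b c : Fin D) :
    w a b c * diracElt γ N y = diracElt γ N y * w a b c := by
  simp only [diracElt, Finset.mul_sum, Finset.sum_mul]
  refine Finset.sum_congr rfl fun d _ => ?_
  rw [← mul_assoc, h.comm_gamma, mul_assoc, h.comm_dElt, mul_assoc]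

/-- The divergence of the Killing–Yano equation. -/
lemma sum_ddElt_diag (h : DiracAlgebra γ N η w y) (hε : ε * ε = 1)
    (hi : ∀ c, (2 * r * η c) • dElt N y c = γ c * diracElt γ N y + ε • (diracElt γ N y * γ c))
    (hii : ∑ a, dElt N y a * γ a = ε • diracElt γ N y)
    (hΩ : ∑ a, ∑ c, γ c * (curv N η w a c * y - y * curv N η w a c) * γ a = 0) :
    r • ∑ a, η a • ddElt N η w y a a = ∑ a, ∑ c, γ a * γ c * ddElt N η w y a c := by
  set t := diracElt γ N y with ht
  -- The commutator of `hi` with `N a`, at the same index; the last sum comes from differentiating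
  -- the explicit `γ a`.
  have e1 : ∀ a, (2 * r * η a) • (N a * dElt N y a - dElt N y a * N a)
      = γ a * (N a * t - t * N a) + ε • ((N a * t - t * N a) * γ a)
        - ∑ c, η a • (w a a c * (γ c * t + ε • (t * γ c))) := by
    intro a
    have h1 : (2 * r * η a) • (N a * dElt N y a - dElt N y a * N a)
        = N a * (γ a * t + ε • (t * γ a)) - (γ a * t + ε • (t * γ a)) * N a := by
      rw [← hi, smul_sub, mul_smul_comm, smul_mul_assoc]
    have h2 : ∑ c, η a • (w a a c * (γ c * t + ε • (t * γ c)))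
        = (∑ c, η a • (w a a c * γ c)) * t + ε • (t * ∑ c, η a • (w a a c * γ c)) := by
      have hct : ∀ b c, w a b c * t = t * w a b c := h.comm_diracElt a
      simp only [Finset.mul_sum, Finset.sum_mul, mul_add, smul_add, Finset.sum_add_distrib,
        Finset.smul_sum, smul_mul_assoc, mul_smul_comm, ← mul_assoc, hct]
      congr 1
      exact Finset.sum_congr rfl fun c _ => smul_comm _ _ _
    have h3 : ∑ c, η a • (w a a c * γ c) = γ a * N a - N a * γ a := by
      rw [← neg_sub, h.deriv_gamma, neg_neg]
    rw [h1, h2, h3]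
    simp only [mul_add, add_mul, mul_sub, sub_mul, mul_smul_comm, smul_mul_assoc, smul_sub,
      mul_assoc]
    abel
  -- By `hi` and the antisymmetry of `w`, that sum is the connection term in `ddElt`, so the
  -- identity becomes covariant.
  have e2 : ∀ a, (2 * r * η a) • ddElt N η w y a a
      = γ a * (N a * t - t * N a) + ε • ((N a * t - t * N a) * γ a) := by
    intro a
    have h1 : ∑ c, η a • (w a a c * (γ c * t + ε • (t * γ c)))
        = -((2 * r * η a) • ∑ m, η m • (w a m a * dElt N y m)) := by
      rw [Finset.smul_sum, ← Finset.sum_neg_distrib]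
      refine Finset.sum_congr rfl fun m _ => ?_
      rw [← hi, h.antisymm a m a, mul_smul_comm]
      simp only [neg_mul, smul_neg, neg_neg, smul_smul]
      congr 1
      ring
    rw [ddElt, smul_sub, e1, h1]
    abel
  -- Exchange the two derivatives; `hΩ` removes the curvature, and `hii` turns the trailing
  -- contraction into `ε • t`.
  have e3 : ∑ a, ∑ c, γ c * ddElt N η w y a c * γ a = ε • ∑ a, ∑ c, γ a * γ c * ddElt N η w y a c := by
    have h1 : ∀ a c, γ c * ddElt N η w y a c * γ a = γ c * (ddElt N η w y c a * γ a)
        + γ c * (curv N η w a c * y - y * curv N η w a c) * γ a := by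
      intro a c
      rw [← h.ddElt_sub_ddElt]
      noncomm_ring
    simp only [h1, Finset.sum_add_distrib, hΩ, add_zero]
    rw [Finset.sum_comm, Finset.smul_sum]
    refine Finset.sum_congr rfl fun c _ => ?_
    rw [← Finset.mul_sum, h.sum_ddElt_mul_gamma, hii, mul_smul_comm, smul_mul_assoc, ← smul_sub,
      h.N_commutator_diracElt, mul_smul_comm, Finset.mul_sum]
    simp only [mul_assoc]
  have e4 : (2 : ℝ) • (r • ∑ a, η a • ddElt N η w y a a)
      = (2 : ℝ) • ∑ a, ∑ c, γ a * γ c * ddElt N η w y a c := by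
    calc (2 : ℝ) • (r • ∑ a, η a • ddElt N η w y a a)
        = ∑ a, (2 * r * η a) • ddElt N η w y a a := by
          simp only [Finset.smul_sum, smul_smul, mul_assoc]
      _ = ∑ a, ∑ c, γ a * γ c * ddElt N η w y a c
          + ε • ∑ a, ∑ c, γ c * ddElt N η w y a c * γ a := by
          rw [Finset.sum_congr rfl fun a _ => e2 a, Finset.sum_add_distrib]
          simp only [ht, h.N_commutator_diracElt, Finset.mul_sum,
            Finset.sum_mul, Finset.smul_sum, mul_assoc]
      _ = _ := by rw [e3, smul_smul, hε, one_smul, two_smul]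
  exact smul_right_injective A (two_ne_zero (α := ℝ)) e4

theorem graded_anticommute (h : DiracAlgebra γ N η w y) (hε : ε * ε = 1) (hr : r ≠ 0)
    (hi : ∀ c, (2 * r * η c) • dElt N y c = γ c * diracElt γ N y + ε • (diracElt γ N y * γ c))
    (hii : ∑ a, dElt N y a * γ a = ε • diracElt γ N y)
    (hΩ : ∑ a, ∑ c, γ c * (curv N η w a c * y - y * curv N η w a c) * γ a = 0)
    (hΩ' : (∑ a, ∑ c, γ a * γ c * curv N η w a c) * y
      = y * ∑ a, ∑ c, γ a * γ c * curv N η w a c) {K : A}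
    (hK : K = (∑ a, γ a * N a) * y - ε • (y * ∑ a, γ a * N a) - r⁻¹ • diracElt γ N y) :
    (∑ a, γ a * N a) * K + ε • (K * ∑ a, γ a * N a) = 0 := by
  set P := ∑ a, γ a * N a with hP
  set t := diracElt γ N y with ht
  set L := ∑ a, η a • hess N η w a a with hL
  set C := ∑ a, ∑ c, γ a * γ c * curv N η w a c with hC
  -- The two terms `ε • P * y * P` cancel because `ε` is a sign.
  have e1 : P * K + ε • (K * P) = (P * P * y - y * (P * P)) - r⁻¹ • (P * t + ε • (t * P)) := by
    rw [hK]
    have : ε • (ε • (y * P * P)) = y * P * P := by rw [smul_smul, hε, one_smul]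
    simp only [mul_sub, sub_mul, smul_sub, mul_smul_comm, smul_mul_assoc, smul_add, mul_assoc]
    simp only [mul_assoc] at this
    rw [this, smul_comm ε r⁻¹]
    abel
  have e2 : P * P = L + (2⁻¹ : ℝ) • C := by
    have := h.sum_gamma_hess
    rw [← h.dirac_sq] at this
    rw [← inv_smul_smul₀ (two_ne_zero (α := ℝ)) (P * P), this, smul_add,
      inv_smul_smul₀ (two_ne_zero (α := ℝ))]
  have e3 : L * y - y * L = ∑ a, η a • ddElt N η w y a a
      + (2 : ℝ) • ∑ a, η a • (dElt N y a * N a) := by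
    simp only [hL, Finset.sum_mul, Finset.mul_sum, smul_mul_assoc, mul_smul_comm,
      ← Finset.sum_sub_distrib, ← smul_sub, h.hess_commutator, smul_add, Finset.sum_add_distrib,
      two_smul]
    abel
  -- `hi` converts the terms in which `N a` stands on the right into the first-order part of `L * y
  -- - y * L`, up to the factor `r`.
  have e4 : P * t + ε • (t * P) = ∑ a, ∑ c, γ a * γ c * ddElt N η w y a c
      + (2 * r) • ∑ a, η a • (dElt N y a * N a) := by
    have h1 : ∀ a, γ a * N a * t + ε • (t * (γ a * N a))
        = γ a * ∑ c, γ c * ddElt N η w y a c + (2 * r) • η a • (dElt N y a * N a) := by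
      intro a
      rw [← h.N_commutator_diracElt, ← ht, smul_smul, ← smul_mul_assoc (2 * r * η a), hi]
      simp only [mul_sub, add_mul, smul_mul_assoc, mul_assoc]
      abel
    simp only [hP, Finset.sum_mul, Finset.mul_sum, Finset.smul_sum, ← Finset.sum_add_distrib, h1]
    simp only [Finset.sum_add_distrib, mul_assoc]
  have e5 : P * P * y - y * (P * P) = ∑ a, η a • ddElt N η w y a a
      + (2 : ℝ) • ∑ a, η a • (dElt N y a * N a) := by
    rw [← e3, e2, add_mul, mul_add, smul_mul_assoc, mul_smul_comm, hΩ']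
    abel
  rw [e1, e5, e4, ← h.sum_ddElt_diag hε hi hii hΩ, smul_add, smul_smul, smul_smul,
    inv_mul_cancel₀ hr, one_smul, show r⁻¹ * (2 * r) = 2 by field_simp]
  abel

end DiracAlgebra
end DiracAlgebra

/-! ### The Levi-Civita connection and its curvature in an orthonormal frame. -/

section Frame

variable {D : ℕ} {M : Type*} [TopologicalSpace M] [ChartedSpace (EuclideanSpace ℝ (Fin D)) M]
  [IsManifold (𝓡 D) ∞ M] {g : PseudoMetric D M} {η : Fin D → ℝ} {E : Fin D → VField D M}
  {U : Set M}

/-- The connection coefficients `ω_{abc} = g(E_b, ∇_{E_a} E_c)`. -/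
def connCoeff (g : PseudoMetric D M) (E : Fin D → VField D M) (a b c : Fin D) (x : M) : ℝ :=
  koszul g (E a) (E c) (E b) x

/-- The structure functions of a frame, `[E_a, E_b] = ∑ m, c_{ab}^m E_m`. -/
def structCoeff (g : PseudoMetric D M) (η : Fin D → ℝ) (E : Fin D → VField D M) (a b m : Fin D)
    (x : M) : ℝ :=
  η m * (connCoeff g E a m b x - connCoeff g E b m a x)

/-- The frame components of the curvature of the Levi-Civita connection. -/
def riemann (g : PseudoMetric D M) (η : Fin D → ℝ) (E : Fin D → VField D M) (x : M)
    (a b j k : Fin D) : ℝ :=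
  dirDeriv (E a) (connCoeff g E b j k) x - dirDeriv (E b) (connCoeff g E a j k) x
    - ∑ m, structCoeff g η E a b m x * connCoeff g E m j k x
    + ∑ l, η l * (connCoeff g E a j l x * connCoeff g E b l k x
      - connCoeff g E b j l x * connCoeff g E a l k x)

namespace IsOrthonormalFrameOn

lemma frame_ne_zero (hE : IsOrthonormalFrameOn g η E U) (hη : ∀ i, η i = 1 ∨ η i = -1) {x : M}
    (hx : x ∈ U) (m : Fin D) : E m x ≠ 0 := by
  intro h
  have h1 := hE.orthonormal x hx m m
  rw [h] at h1
  rcases hη m with h2 | h2 <;> simp [h2] at h1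

lemma val_sum (hE : IsOrthonormalFrameOn g η E U) {x : M} (hx : x ∈ U) (c : Fin D → ℝ)
    (n : Fin D) : g.val x (∑ m, c m • E m x) (E n x) = c n * η n := by
  simp only [map_sum, map_smul, LinearMap.sum_apply, LinearMap.smul_apply,
    hE.orthonormal x hx, smul_eq_mul, mul_ite, mul_zero]
  simp

lemma coeff_ext (hE : IsOrthonormalFrameOn g η E U) (hη : ∀ i, η i = 1 ∨ η i = -1) {x : M}
    (hx : x ∈ U) {c d : Fin D → ℝ} (h : ∑ m, c m • E m x = ∑ m, d m • E m x) (n : Fin D) :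
    c n = d n := by
  have h1 := hE.val_sum hx c n
  rw [h, hE.val_sum hx d n] at h1
  rcases hη n with h2 | h2 <;> simp [h2] at h1 <;> linarith

lemma eq_sum (hE : IsOrthonormalFrameOn g η E U) (hη : ∀ i, η i = 1 ∨ η i = -1) {x : M}
    (hx : x ∈ U) (v : TangentSpace (𝓡 D) x) :
    v = ∑ m, (η m * g.val x v (E m x)) • E m x := by
  have hli : LinearIndependent ℝ fun m => E m x := by
    rw [Fintype.linearIndependent_iff]
    intro c hc n
    exact hE.coeff_ext hη hx (d := 0) (by simpa using hc) n
  have hf : Module.finrank ℝ (TangentSpace (𝓡 D) x) = D := by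
    change Module.finrank ℝ (EuclideanSpace ℝ (Fin D)) = D
    simp
  have : FiniteDimensional ℝ (TangentSpace (𝓡 D) x) :=
    inferInstanceAs (FiniteDimensional ℝ (EuclideanSpace ℝ (Fin D)))
  have hspan : Submodule.span ℝ (Set.range fun m => E m x) = ⊤ :=
    hli.span_eq_top_of_card_eq_finrank' (by rw [hf, Fintype.card_fin])
  have hv : v ∈ Submodule.span ℝ (Set.range fun m => E m x) := hspan ▸ Submodule.mem_top
  obtain ⟨c, rfl⟩ := (Submodule.mem_span_range_iff_exists_fun ℝ).1 hv
  refine Finset.sum_congr rfl fun m _ => ?_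
  rw [hE.val_sum hx]
  rcases hη m with h2 | h2 <;> simp [h2]

lemma smooth_connCoeff (hE : IsOrthonormalFrameOn g η E U) (hU : IsOpen U) (a b c : Fin D) :
    ContMDiffOn (𝓡 D) 𝓘(ℝ, ℝ) ∞ (connCoeff g E a b c) U := by
  have hs := hE.smooth
  have hd : ∀ i j k, ContMDiffOn (𝓡 D) 𝓘(ℝ, ℝ) ∞
      (dirDeriv (E i) fun y => g.val y (E j y) (E k y)) U := fun i j k =>
    contMDiffOn_dirDeriv hU (hs i) (g.smooth U _ _ hU (hs j) (hs k))
  have hb : ∀ i j k, ContMDiffOn (𝓡 D) 𝓘(ℝ, ℝ) ∞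
      (fun y => g.val y (bracket (E i) (E j) y) (E k y)) U := fun i j k =>
    g.smooth U _ _ hU ((hs i).bracket hU (hs j)) (hs k)
  exact contMDiffOn_const.mul ((((((hd _ _ _).add (hd _ _ _)).sub (hd _ _ _)).add (hb _ _ _)).sub
    (hb _ _ _)).add (hb _ _ _))

/-- The metric components in the frame are constant, so only the bracket terms of the Koszul formula
survive. -/
lemma connCoeff_eq (hE : IsOrthonormalFrameOn g η E U) (hU : IsOpen U) {x : M} (hx : x ∈ U)
    (a b c : Fin D) : connCoeff g E a b c x = (1 / 2 : ℝ) * (g.val x (bracket (E a) (E c) x) (E b x)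
      - g.val x (bracket (E c) (E b) x) (E a x) + g.val x (bracket (E b) (E a) x) (E c x)) := by
  have h : ∀ i j k, dirDeriv (E i) (fun y => g.val y (E j y) (E k y)) x = 0 := fun i j k => by
    rw [dirDeriv_congr hU (fun y hy => hE.orthonormal y hy j k) hx, dirDeriv_const]
  simp only [connCoeff, koszul, h]
  ring

lemma connCoeff_antisymm (hE : IsOrthonormalFrameOn g η E U) (hU : IsOpen U) {x : M} (hx : x ∈ U)
    (a b c : Fin D) : connCoeff g E a b c x = -connCoeff g E a c b x := by
  rw [hE.connCoeff_eq hU hx, hE.connCoeff_eq hU hx, bracket_swap (E b) (E a),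
    bracket_swap (E c) (E a), bracket_swap (E b) (E c)]
  simp only [map_neg, LinearMap.neg_apply]
  ring

/-- This is the absence of torsion: the antisymmetrized connection coefficients are the structure
functions. -/
lemma bracket_eq_sum (hE : IsOrthonormalFrameOn g η E U) (hη : ∀ i, η i = 1 ∨ η i = -1)
    (hU : IsOpen U) {x : M} (hx : x ∈ U) (a b : Fin D) :
    bracket (E a) (E b) x = ∑ m, structCoeff g η E a b m x • E m x := by
  nth_rw 1 [hE.eq_sum hη hx (bracket (E a) (E b) x)]
  refine Finset.sum_congr rfl fun m _ => ?_
  congr 1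
  rw [structCoeff, hE.connCoeff_eq hU hx, hE.connCoeff_eq hU hx, bracket_swap (E b) (E a),
    bracket_swap (E m) (E a), bracket_swap (E m) (E b)]
  simp only [map_neg, LinearMap.neg_apply]
  ring

lemma smooth_structCoeff (hE : IsOrthonormalFrameOn g η E U) (hU : IsOpen U) (a b m : Fin D) :
    ContMDiffOn (𝓡 D) 𝓘(ℝ, ℝ) ∞ (structCoeff g η E a b m) U :=
  contMDiffOn_const.mul ((hE.smooth_connCoeff hU _ _ _).sub (hE.smooth_connCoeff hU _ _ _))

lemma dirDeriv_commutator {V : Type*} [NormedAddCommGroup V] [NormedSpace ℝ V]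
    (hE : IsOrthonormalFrameOn g η E U) (hη : ∀ i, η i = 1 ∨ η i = -1)
    (hU : IsOpen U) {f : M → V} (hf : ContMDiffOn (𝓡 D) 𝓘(ℝ, V) ∞ f U) {x : M} (hx : x ∈ U)
    (a b : Fin D) :
    dirDeriv (E a) (dirDeriv (E b) f) x - dirDeriv (E b) (dirDeriv (E a) f) x
      = ∑ m, structCoeff g η E a b m x • dirDeriv (E m) f x := by
  rw [← dirDeriv_bracket hU (hE.smooth a) (hE.smooth b) (hE.smooth a) hf hx
    (hE.frame_ne_zero hη hx a)]
  exact dirDeriv_sum_vfield _ _ _ _ _ _ (hE.bracket_eq_sum hη hU hx a b)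

lemma bracket_bracket (hE : IsOrthonormalFrameOn g η E U) (hη : ∀ i, η i = 1 ∨ η i = -1)
    (hU : IsOpen U) {x : M} (hx : x ∈ U) (a b d : Fin D) :
    bracket (E a) (bracket (E b) (E d)) x
      = ∑ n, (dirDeriv (E a) (structCoeff g η E b d n) x
        + ∑ m, structCoeff g η E b d m x * structCoeff g η E a m n x) • E n x := by
  have h1 : ∀ m, IsSmoothVFieldOn (structCoeff g η E b d m • E m) U := fun m =>
    (hE.smooth m).smul (hE.smooth_structCoeff hU b d m)
  rw [bracket_congr_right hU (Z' := ∑ m, structCoeff g η E b d m • E m)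
    (fun y hy => by rw [hE.bracket_eq_sum hη hU hy]; simp [Finset.sum_apply]) hx,
    bracket_sum_right _ hU h1 hx]
  simp only [bracket_smul_right hU (hE.smooth_structCoeff hU b d _) (hE.smooth _) hx,
    hE.bracket_eq_sum hη hU hx, Finset.sum_add_distrib, add_smul, Finset.sum_smul,
    Finset.smul_sum, smul_smul]
  rw [Finset.sum_comm]

lemma jacobi (hE : IsOrthonormalFrameOn g η E U) (hη : ∀ i, η i = 1 ∨ η i = -1)
    (hU : IsOpen U) {x : M} (hx : x ∈ U) (a b d n : Fin D) :
    (dirDeriv (E a) (structCoeff g η E b d n) x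
        + ∑ m, structCoeff g η E b d m x * structCoeff g η E a m n x)
      + (dirDeriv (E b) (structCoeff g η E d a n) x
        + ∑ m, structCoeff g η E d a m x * structCoeff g η E b m n x)
      + (dirDeriv (E d) (structCoeff g η E a b n) x
        + ∑ m, structCoeff g η E a b m x * structCoeff g η E d m n x) = 0 := by
  have h := bracket_jacobi hU (hE.smooth a) (hE.smooth b) (hE.smooth d) hx
  rw [bracket_swap (bracket (E a) (E b)), bracket_congr_right hU
    (X := E b) (Z' := (-1 : M → ℝ) • bracket (E d) (E a))
    (fun y _ => by rw [bracket_swap]; simp) hx,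
    bracket_smul_right hU (f := -1) (contMDiffOn_const (c := (-1 : ℝ))) ((hE.smooth d).bracket hU (hE.smooth a)) hx] at h
  have h0 : dirDeriv (E b) (-1 : M → ℝ) x = 0 := dirDeriv_const _ (-1) x
  rw [h0] at h
  have h1 : bracket (E a) (bracket (E b) (E d)) x + bracket (E b) (bracket (E d) (E a)) x
      + bracket (E d) (bracket (E a) (E b)) x = 0 := by
    rw [h]
    simp
  simp only [hE.bracket_bracket hη hU hx, ← Finset.sum_add_distrib, ← add_smul] at h1
  exact hE.coeff_ext hη hx (d := 0) (by simpa using h1) n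

lemma dirDeriv_structCoeff (hE : IsOrthonormalFrameOn g η E U) (hU : IsOpen U) {x : M}
    (hx : x ∈ U) (i a b m : Fin D) :
    dirDeriv (E i) (structCoeff g η E a b m) x
      = η m * (dirDeriv (E i) (connCoeff g E a m b) x
        - dirDeriv (E i) (connCoeff g E b m a) x) := by
  have h1 := hE.smooth_connCoeff hU a m b
  have h2 := hE.smooth_connCoeff hU b m a
  have e := dirDeriv_clm hU (X := E i) (η m • ContinuousLinearMap.id ℝ ℝ) (h1.sub h2) hx
  have e' : dirDeriv (E i) (connCoeff g E a m b - connCoeff g E b m a) x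
      = dirDeriv (E i) (connCoeff g E a m b) x - dirDeriv (E i) (connCoeff g E b m a) x := by
    simp [dirDeriv, mvfderiv_sub (mdifferentiableAt_of_contMDiffOn hU h1 hx)
      (mdifferentiableAt_of_contMDiffOn hU h2 hx)]
  rw [← e']
  exact e

lemma isRiemannTensor (hE : IsOrthonormalFrameOn g η E U) (hη : ∀ i, η i = 1 ∨ η i = -1)
    (hU : IsOpen U) {x : M} (hx : x ∈ U) : IsRiemannTensor (riemann g η E x) where
  antisymm_left a b j k := by
    have h : ∀ m, structCoeff g η E a b m x = -structCoeff g η E b a m x := fun m => by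
      rw [structCoeff, structCoeff]
      ring
    have h2 : ∀ l, connCoeff g E a j l x * connCoeff g E b l k x
      - connCoeff g E b j l x * connCoeff g E a l k x
      = -(connCoeff g E b j l x * connCoeff g E a l k x
      - connCoeff g E a j l x * connCoeff g E b l k x) := fun l => by ring
    simp only [riemann, h, h2, neg_mul, mul_neg, Finset.sum_neg_distrib]
    ring
  antisymm_right a b j k := by
    have hs := hE.connCoeff_antisymm hU hx
    have hd : ∀ i m, dirDeriv (E i) (connCoeff g E m j k) x
        = -dirDeriv (E i) (connCoeff g E m k j) x := fun i m => by
      rw [dirDeriv_congr hU (f' := -connCoeff g E m k j)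
        (fun y hy => hE.connCoeff_antisymm hU hy m j k) hx]
      simp [dirDeriv, mvfderiv_neg]
    have h1 : ∀ m, structCoeff g η E a b m x * connCoeff g E m j k x
        = -(structCoeff g η E a b m x * connCoeff g E m k j x) := fun m => by
      rw [hs m j k]
      ring
    have h2 : ∀ l, η l * (connCoeff g E a j l x * connCoeff g E b l k x
        - connCoeff g E b j l x * connCoeff g E a l k x)
        = -(η l * (connCoeff g E a k l x * connCoeff g E b l j x
        - connCoeff g E b k l x * connCoeff g E a l j x)) := fun l => by
      rw [hs a j l, hs b l k, hs b j l, hs a l k]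
      ring
    simp only [riemann, hd, h1, h2, Finset.sum_neg_distrib]
    ring
  bianchi a b k j := by
    have hη2 : η j * η j = 1 := by rcases hη j with h | h <;> simp [h]
    have hJ := hE.jacobi hη hU hx a b k j
    simp only [hE.dirDeriv_structCoeff hU hx] at hJ
    -- Writes one structure function of each product through the connection, so that the Jacobi
    -- identity of the frame becomes `η j` times the Bianchi identity.
    have hq : ∀ a b k, ∑ m, structCoeff g η E b k m x * structCoeff g η E a m j x
        = η j * (∑ l, η l * (connCoeff g E a j l x * connCoeff g E b l k x
            - connCoeff g E a j l x * connCoeff g E k l b x)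
          - ∑ m, structCoeff g η E b k m x * connCoeff g E m j a x) := by
      intro a b k
      rw [← Finset.sum_sub_distrib, Finset.mul_sum]
      refine Finset.sum_congr rfl fun m _ => ?_
      simp only [structCoeff]
      ring
    rw [hq a b k, hq b k a, hq k a b] at hJ
    simp only [riemann, mul_sub, Finset.sum_sub_distrib] at hJ ⊢
    refine mul_left_cancel₀ (a := η j) (fun h => by simp [h] at hη2) ?_
    rw [mul_zero]
    linear_combination hJ

end IsOrthonormalFrameOn
end Frame

/-! ### The ring of operators on local sections. -/

section Sections

variable {D : ℕ} {M : Type*} [TopologicalSpace M] [ChartedSpace (EuclideanSpace ℝ (Fin D)) M]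
  {S : Type*} [NormedAddCommGroup S] [NormedSpace ℂ S]

variable (D S) in
/-- The functions `M → S` that are smooth on `U` and vanish outside of `U`. -/
def smoothSections (U : Set M) : Submodule ℝ (M → S) where
  carrier := {v | ContMDiffOn (𝓡 D) 𝓘(ℝ, S) ∞ v U ∧ ∀ x ∉ U, v x = 0}
  add_mem' := fun ha hb => ⟨ha.1.add hb.1, fun x hx => by simp [ha.2 x hx, hb.2 x hx]⟩
  zero_mem' := ⟨contMDiffOn_const, fun _ _ => rfl⟩
  smul_mem' := fun c _ ha =>
    ⟨(contMDiffOn_const : ContMDiffOn (𝓡 D) 𝓘(ℝ, ℝ) ∞ (fun _ : M => c) U).smul ha.1,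
      fun x hx => by simp [ha.2 x hx]⟩

variable {U : Set M}

/-- Vanishing outside `U` makes a section determined by its values on `U`, so operator identities
can be checked pointwise there. -/
lemma sections_ext {u v : smoothSections D S U} (h : ∀ x ∈ U, u.1 x = v.1 x) : u = v := by
  refine Subtype.ext (funext fun x => ?_)
  by_cases hx : x ∈ U
  · exact h x hx
  · rw [u.2.2 x hx, v.2.2 x hx]

lemma indicator_mem_sections {f : M → S} (hf : ContMDiffOn (𝓡 D) 𝓘(ℝ, S) ∞ f U) :
    U.indicator f ∈ smoothSections D S U :=
  ⟨hf.congr fun _ hx => Set.indicator_of_mem hx f, fun _ hx => Set.indicator_of_notMem hx f⟩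

/-- A field of endomorphisms that maps smooth functions to smooth functions. -/
def IsSmoothEnd (D : ℕ) {M : Type*} [TopologicalSpace M]
    [ChartedSpace (EuclideanSpace ℝ (Fin D)) M] (U : Set M) (L : M → Module.End ℂ S) : Prop :=
  ∀ v : M → S, ContMDiffOn (𝓡 D) 𝓘(ℝ, S) ∞ v U →
    ContMDiffOn (𝓡 D) 𝓘(ℝ, S) ∞ (fun x => L x (v x)) U

lemma isSmoothEnd_const [FiniteDimensional ℂ S] (C : Module.End ℂ S) :
    IsSmoothEnd D U fun _ : M => C := fun _ hv =>
  ((LinearMap.toContinuousLinearMap C).restrictScalars ℝ).contMDiff.comp_contMDiffOn hv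

lemma IsSmoothEnd.smul {L : M → Module.End ℂ S} (hL : IsSmoothEnd D U L) {f : M → ℝ}
    (hf : ContMDiffOn (𝓡 D) 𝓘(ℝ, ℝ) ∞ f U) : IsSmoothEnd D U fun x => f x • L x :=
  fun v hv => hf.smul (hL v hv)

lemma IsSmoothEnd.sub {L L' : M → Module.End ℂ S} (hL : IsSmoothEnd D U L)
    (hL' : IsSmoothEnd D U L') : IsSmoothEnd D U fun x => L x - L' x :=
  fun v hv => (hL v hv).sub (hL' v hv)

lemma isSmoothEnd_sum {ι : Type*} (s : Finset ι) {L : ι → M → Module.End ℂ S}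
    (hL : ∀ i, IsSmoothEnd D U (L i)) : IsSmoothEnd D U fun x => ∑ i ∈ s, L i x := fun v hv => by
  simp only [LinearMap.sum_apply]
  exact contMDiffOn_finsetSum fun i _ => hL i v hv

/-- The operator of multiplication by a field of endomorphisms. -/
def mulOp (L : M → Module.End ℂ S) (hL : IsSmoothEnd D U L) : Module.End ℝ (smoothSections D S U) where
  toFun v := ⟨fun x => L x (v.1 x), hL _ v.2.1, fun x hx => by simp [v.2.2 x hx]⟩
  map_add' u v := Subtype.ext (funext fun x => (L x).map_add _ _)
  map_smul' c v := Subtype.ext (funext fun x => ((L x).restrictScalars ℝ).map_smul c _)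

/-- The operator `O` is the multiplication by the field of endomorphisms `L` on `U`. -/
def IsMulBy (O : Module.End ℝ (smoothSections D S U)) (L : M → Module.End ℂ S) : Prop :=
  ∀ v : smoothSections D S U, ∀ x ∈ U, (O v).1 x = L x (v.1 x)

lemma isMulBy_mulOp (L : M → Module.End ℂ S) (hL : IsSmoothEnd D U L) :
    IsMulBy (mulOp L hL) L := fun _ _ _ => rfl

namespace IsMulBy

variable {O O' : Module.End ℝ (smoothSections D S U)} {L L' : M → Module.End ℂ S}

lemma ext (h : IsMulBy O L) (h' : IsMulBy O' L') (e : ∀ x ∈ U, L x = L' x) : O = O' :=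
  LinearMap.ext fun v => sections_ext fun x hx => by rw [h v x hx, h' v x hx, e x hx]

lemma congr (h : IsMulBy O L) (e : ∀ x ∈ U, L x = L' x) : IsMulBy O L' :=
  fun v x hx => by rw [h v x hx, e x hx]

lemma add (h : IsMulBy O L) (h' : IsMulBy O' L') : IsMulBy (O + O') fun x => L x + L' x :=
  fun v x hx => by simp [h v x hx, h' v x hx]

lemma sub (h : IsMulBy O L) (h' : IsMulBy O' L') : IsMulBy (O - O') fun x => L x - L' x :=
  fun v x hx => by simp [h v x hx, h' v x hx]

lemma neg (h : IsMulBy O L) : IsMulBy (-O) fun x => -L x :=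
  fun v x hx => by simp [h v x hx]

lemma mul (h : IsMulBy O L) (h' : IsMulBy O' L') : IsMulBy (O * O') fun x => L x * L' x :=
  fun v x hx => by rw [Module.End.mul_apply, Module.End.mul_apply, h _ x hx, h' v x hx]

lemma smul (c : ℝ) (h : IsMulBy O L) : IsMulBy (c • O) fun x => c • L x :=
  fun v x hx => by simp [h v x hx]

lemma sum {ι : Type*} (s : Finset ι) {O : ι → Module.End ℝ (smoothSections D S U)}
    {L : ι → M → Module.End ℂ S} (h : ∀ i, IsMulBy (O i) (L i)) :
    IsMulBy (∑ i ∈ s, O i) fun x => ∑ i ∈ s, L i x := fun v x hx => by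
  simp only [LinearMap.sum_apply, Submodule.coe_sum, Finset.sum_apply, h _ v x hx]

end IsMulBy

lemma isMulBy_one : IsMulBy (1 : Module.End ℝ (smoothSections D S U)) fun _ => 1 := fun _ _ _ => rfl

lemma isMulBy_zero : IsMulBy (0 : Module.End ℝ (smoothSections D S U)) fun _ => 0 := fun _ _ _ => rfl

/-- `L'` is the derivative of the field of endomorphisms `L` along `X` on `U`. -/
def HasEndDeriv (U : Set M) (X : VField D M) (L L' : M → Module.End ℂ S) : Prop :=
  ∀ v : M → S, ContMDiffOn (𝓡 D) 𝓘(ℝ, S) ∞ v U → ∀ x ∈ U,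
    dirDeriv X (fun y => L y (v y)) x = L x (dirDeriv X v x) + L' x (v x)

lemma hasEndDeriv_smul_const [FiniteDimensional ℂ S] (hU : IsOpen U) (X : VField D M)
    (C : Module.End ℂ S) {f : M → ℝ} (hf : ContMDiffOn (𝓡 D) 𝓘(ℝ, ℝ) ∞ f U) :
    HasEndDeriv U X (fun x => f x • C) fun x => dirDeriv X f x • C := fun v hv x hx => by
  have h := dirDeriv_smul hU (X := X) hf (isSmoothEnd_const C v hv) hx
  have h' := dirDeriv_clm hU (X := X) ((LinearMap.toContinuousLinearMap C).restrictScalars ℝ) hv hx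
  simp only [ContinuousLinearMap.coe_restrictScalars', LinearMap.coe_toContinuousLinearMap'] at h'
  rw [h'] at h
  exact h

lemma hasEndDeriv_const [FiniteDimensional ℂ S] (hU : IsOpen U) (X : VField D M)
    (C : Module.End ℂ S) : HasEndDeriv U X (fun _ => C) fun _ => 0 := fun v hv x hx => by
  have h' := dirDeriv_clm hU (X := X) ((LinearMap.toContinuousLinearMap C).restrictScalars ℝ) hv hx
  simpa using h'

lemma HasEndDeriv.const_smul (hU : IsOpen U) {X : VField D M} {L L' : M → Module.End ℂ S}
    (hL : IsSmoothEnd D U L) (h : HasEndDeriv U X L L') (c : ℝ) :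
    HasEndDeriv U X (fun x => c • L x) fun x => c • L' x := fun v hv x hx => by
  have e := dirDeriv_clm hU (X := X) (c • ContinuousLinearMap.id ℝ S) (hL v hv) hx
  rw [h v hv x hx] at e
  exact e.trans (smul_add _ _ _)

lemma HasEndDeriv.sub (hU : IsOpen U) {X : VField D M} {L L' K K' : M → Module.End ℂ S}
    (hL : IsSmoothEnd D U L) (hK : IsSmoothEnd D U K) (h : HasEndDeriv U X L L')
    (h' : HasEndDeriv U X K K') :
    HasEndDeriv U X (fun x => L x - K x) fun x => L' x - K' x := fun v hv x hx => by
  have e : dirDeriv X (fun y => L y (v y) - K y (v y)) x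
      = dirDeriv X (fun y => L y (v y)) x - dirDeriv X (fun y => K y (v y)) x := by
    simp [dirDeriv, mvfderiv_fun_sub (mdifferentiableAt_of_contMDiffOn hU (hL v hv) hx)
      (mdifferentiableAt_of_contMDiffOn hU (hK v hv) hx)]
  simp only [LinearMap.sub_apply]
  rw [e, h v hv x hx, h' v hv x hx]
  abel

lemma HasEndDeriv.sum (hU : IsOpen U) {X : VField D M} {ι : Type*} (s : Finset ι)
    {L L' : ι → M → Module.End ℂ S} (hL : ∀ i, IsSmoothEnd D U (L i))
    (h : ∀ i, HasEndDeriv U X (L i) (L' i)) :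
    HasEndDeriv U X (fun x => ∑ i ∈ s, L i x) fun x => ∑ i ∈ s, L' i x := by
  classical
  induction s using Finset.induction_on with
  | empty => exact fun v hv x hx => by simp [dirDeriv_const]
  | insert i s hi ih =>
    intro v hv x hx
    have e : dirDeriv X (fun y => L i y (v y) + (∑ i ∈ s, L i y) (v y)) x
        = dirDeriv X (fun y => L i y (v y)) x + dirDeriv X (fun y => (∑ i ∈ s, L i y) (v y)) x :=
      dirDeriv_add hU (hL i v hv) (isSmoothEnd_sum s hL v hv) hx
    simp only [Finset.sum_insert hi, LinearMap.add_apply]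
    rw [e, ih v hv x hx, h i v hv x hx]
    abel

variable [IsManifold (𝓡 D) ∞ M]

/-- The derivative of sections along a smooth vector field. -/
def derivOp (hU : IsOpen U) (X : VField D M) (hX : IsSmoothVFieldOn X U) :
    Module.End ℝ (smoothSections D S U) where
  toFun v := ⟨U.indicator (dirDeriv X v.1), indicator_mem_sections (contMDiffOn_dirDeriv hU hX v.2.1)⟩
  map_add' u v := sections_ext fun x hx => by
    simp [Set.indicator_of_mem hx, dirDeriv_add hU u.2.1 v.2.1 hx]
  map_smul' c v := sections_ext fun x hx => by
    have h := dirDeriv_clm hU (X := X) (c • ContinuousLinearMap.id ℝ S) v.2.1 hx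
    simp only [SetLike.val_smul, Set.indicator_of_mem hx, RingHom.id_apply, Pi.smul_apply]
    exact h

lemma derivOp_apply (hU : IsOpen U) (X : VField D M) (hX : IsSmoothVFieldOn X U)
    (v : smoothSections D S U) {x : M} (hx : x ∈ U) : (derivOp hU X hX v).1 x = dirDeriv X v.1 x :=
  Set.indicator_of_mem hx _

lemma IsMulBy.commutator_derivOp (hU : IsOpen U) {X : VField D M} (hX : IsSmoothVFieldOn X U)
    {O : Module.End ℝ (smoothSections D S U)} {L L' : M → Module.End ℂ S} (hO : IsMulBy O L)
    (h : HasEndDeriv U X L L') : IsMulBy (derivOp hU X hX * O - O * derivOp hU X hX) L' := by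
  intro v x hx
  simp only [LinearMap.sub_apply, Module.End.mul_apply, Submodule.coe_sub, Pi.sub_apply]
  rw [hO _ x hx, derivOp_apply hU X hX _ hx, derivOp_apply hU X hX _ hx,
    dirDeriv_congr hU (hO v) hx, h v.1 v.2.1 x hx]
  abel

end Sections

/-! ### The Lie algebra of quadratic Clifford elements. -/

section QuadGamma

variable {D : ℕ} {B : Type*} [Ring B] [Algebra ℝ B]

/-- The quadratic element `∑ w_{jk} γ^j γ^k`. -/
def quadGamma (γ : Fin D → B) (w : Fin D → Fin D → ℝ) : B := ∑ j, ∑ k, w j k • (γ j * γ k)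

lemma quadGamma_eq_slash (γ : Fin D → B) (w : Fin D → Fin D → ℝ) :
    quadGamma γ w = slash γ fun b : Fin 2 → Fin D => w (b 0) (b 1) := by
  have h : ∀ a c : Fin D, (Fin.cons a (Fin.cons c Fin.elim0) : Fin 2 → Fin D) 1 = c :=
    fun _ _ => rfl
  simp only [slash_succ, slash_zero, Fin.cons_zero, Finset.mul_sum, mul_smul_comm, mul_one,
    quadGamma, h]

lemma quadGamma_sub (γ : Fin D → B) (v w : Fin D → Fin D → ℝ) :
    quadGamma γ (fun j k => v j k - w j k) = quadGamma γ v - quadGamma γ w := by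
  simp only [quadGamma, sub_smul, Finset.sum_sub_distrib]

lemma quadGamma_add (γ : Fin D → B) (v w : Fin D → Fin D → ℝ) :
    quadGamma γ (fun j k => v j k + w j k) = quadGamma γ v + quadGamma γ w := by
  simp only [quadGamma, add_smul, Finset.sum_add_distrib]

lemma quadGamma_smul (γ : Fin D → B) (c : ℝ) (w : Fin D → Fin D → ℝ) :
    quadGamma γ (fun j k => c * w j k) = c • quadGamma γ w := by
  simp only [quadGamma, mul_smul, Finset.smul_sum]

lemma quadGamma_sum {ι : Type*} (s : Finset ι) (γ : Fin D → B) (w : ι → Fin D → Fin D → ℝ) :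
    quadGamma γ (fun j k => ∑ i ∈ s, w i j k) = ∑ i ∈ s, quadGamma γ (w i) := by
  simp only [quadGamma_eq_slash]
  exact slash_sum γ s fun i b => w i (b 0) (b 1)

variable {γ : Fin D → B} {η : Fin D → ℝ}

/-- The second element is the slash of a two-index array, on which the first acts as a derivation;
this is the matrix commutator in the metric `η`. -/
lemma quadGamma_commutator (hγ : IsClifford γ η) {v : Fin D → Fin D → ℝ}
    (hv : ∀ j k, v j k = -v k j) (w : Fin D → Fin D → ℝ) :
    quadGamma γ v * quadGamma γ w - quadGamma γ w * quadGamma γ v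
      = (4 : ℝ) • quadGamma γ fun j k => ∑ l, η l * (v j l * w l k - w j l * v l k) := by
  rw [← quadGamma_smul, quadGamma_eq_slash γ w]
  rw [quadGamma, commutator_quadratic_slash hγ hv, quadGamma_eq_slash]
  congr 1
  funext b
  have h0 : ∀ l, Function.update b 0 l 1 = b 1 := fun l => by simp
  have h1 : ∀ l, Function.update b 1 l 0 = b 0 := fun l => by simp
  simp only [derivAction, Fin.sum_univ_two, Function.update_self, h0, h1, Finset.mul_sum,
    ← Finset.sum_add_distrib]
  refine Finset.sum_congr rfl fun l _ => ?_
  rw [hv l (b 0)]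
  ring

end QuadGamma

/-! ### Connection matrices and the curvature of the charged spin connection. -/

section LocalOperators

variable {D : ℕ} {M : Type*} [TopologicalSpace M] [ChartedSpace (EuclideanSpace ℝ (Fin D)) M]
  [IsManifold (𝓡 D) ∞ M] {g : PseudoMetric D M} {η : Fin D → ℝ} {E : Fin D → VField D M}
  {U : Set M} {S : Type*} [NormedAddCommGroup S] [NormedSpace ℂ S]

/-- The connection matrix of the charged spin connection. -/
def connEnd (g : PseudoMetric D M) (E : Fin D → VField D M) (γ : Fin D → Module.End ℂ S)
    (A : CovectorField D M) (e : ℝ) (a : Fin D) (x : M) : Module.End ℂ S :=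
  (1 / 4 : ℝ) • quadGamma γ (fun j k => connCoeff g E a j k x)
    - A x (E a x) • ((Complex.I * (e : ℂ)) • (1 : Module.End ℂ S))

/-- The components of a form in a frame. -/
def formComp (E : Fin D → VField D M) {k : ℕ} (Y : FormField D M k) (x : M)
    (b : Fin k → Fin D) : ℝ := Y x fun l => E (b l) x

lemma isAlternating_formComp (E : Fin D → VField D M) {k : ℕ} (Y : FormField D M k) (x : M) :
    IsAlternating (formComp E Y x) :=
  isAlternating_alternatingMap (Y x) fun a => E a x

lemma smooth_formComp (hE : IsOrthonormalFrameOn g η E U) (hU : IsOpen U) {k : ℕ}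
    {Y : FormField D M k} (hY : IsSmoothForm Y) (b : Fin k → Fin D) :
    ContMDiffOn (𝓡 D) 𝓘(ℝ, ℝ) ∞ (fun x => formComp E Y x b) U :=
  hY U (fun l => E (b l)) hU fun l => hE.smooth (b l)

/-- Puts the connection terms in the form produced by commuting with the spin connection. -/
lemma covDerivForm_cons (g : PseudoMetric D M) (η : Fin D → ℝ) (E : Fin D → VField D M) {k : ℕ}
    (Y : FormField D M k) (x : M) (a : Fin D) (b : Fin k → Fin D) :
    covDerivForm g η E Y x (Fin.cons a b) = dirDeriv (E a) (fun y => formComp E Y y b) x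
      + derivAction (fun l j => -η l * connCoeff g E a l j x) (formComp E Y x) b := by
  have h : ∀ (i : Fin k) (m : Fin D), Y x (Function.update (fun l => E (b l) x) i (E m x))
      = formComp E Y x (Function.update b i m) := by
    intro i m
    rw [formComp]
    congr 1
    funext l
    by_cases hl : l = i
    · subst hl
      simp
    · simp [hl]
  simp only [covDerivForm, Fin.cons_zero, Fin.cons_succ, derivAction, sub_eq_add_neg,
    ← Finset.sum_neg_distrib]
  congr 1
  refine Finset.sum_congr rfl fun i _ => ?_
  rw [AlternatingMap.map_update_sum, ← Finset.sum_neg_distrib]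
  refine Finset.sum_congr rfl fun m _ => ?_
  rw [AlternatingMap.map_update_smul, h, smul_eq_mul, connCoeff]
  ring

lemma derivAction_fieldStrength_eq_zero (hU : IsOpen U) (hE : IsOrthonormalFrameOn g η E U)
    {A : CovectorField D M} {n : ℕ} {Y : FormField D M (n + 1)} (hlift : LiftCondition g η A Y)
    {x : M} (hx : x ∈ U) :
    derivAction (fun l j => η l * fieldStrength A (E l) (E j) x) (formComp E Y x) = 0 := by
  funext a
  refine derivAction_eq_zero_of_antisymm _ (isAlternating_formComp E Y x) a ?_
  rw [← hlift U E hU hE x hx a]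
  congr 1
  funext a'
  refine Finset.sum_congr rfl fun b _ => ?_
  congr 1
  rw [formComp]
  congr 1
  exact Fin.comp_snoc (fun c => E c x) (fun k : Fin n => a' k.succ) b

lemma fieldStrength_swap (A : CovectorField D M) (X Z : VField D M) (x : M) :
    fieldStrength A X Z x = -fieldStrength A Z X x := by
  rw [fieldStrength, fieldStrength, bracket_swap X Z, map_neg]
  ring

variable [FiniteDimensional ℂ S] {γ : Fin D → Module.End ℂ S} {A : CovectorField D M} {e : ℝ}

lemma isSmoothEnd_quadGamma {w : Fin D → Fin D → M → ℝ}
    (hw : ∀ j k, ContMDiffOn (𝓡 D) 𝓘(ℝ, ℝ) ∞ (w j k) U) :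
    IsSmoothEnd D U fun x => quadGamma γ fun j k => w j k x :=
  isSmoothEnd_sum _ fun j => isSmoothEnd_sum _ fun k => (isSmoothEnd_const _).smul (hw j k)

lemma isSmoothEnd_slash {k : ℕ} {Y : (Fin k → Fin D) → M → ℝ}
    (hY : ∀ b, ContMDiffOn (𝓡 D) 𝓘(ℝ, ℝ) ∞ (Y b) U) :
    IsSmoothEnd D U fun x => slash γ fun b => Y b x :=
  isSmoothEnd_sum _ fun b => (isSmoothEnd_const _).smul (hY b)

lemma hasEndDeriv_slash (hU : IsOpen U) (X : VField D M) {k : ℕ} {Y : (Fin k → Fin D) → M → ℝ}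
    (hY : ∀ b, ContMDiffOn (𝓡 D) 𝓘(ℝ, ℝ) ∞ (Y b) U) :
    HasEndDeriv U X (fun x => slash γ fun b => Y b x)
      fun x => slash γ fun b => dirDeriv X (Y b) x :=
  HasEndDeriv.sum hU _ (fun b => (isSmoothEnd_const _).smul (hY b)) fun b =>
    hasEndDeriv_smul_const hU X _ (hY b)

lemma hasEndDeriv_quadGamma (hU : IsOpen U) (X : VField D M) {w : Fin D → Fin D → M → ℝ}
    (hw : ∀ j k, ContMDiffOn (𝓡 D) 𝓘(ℝ, ℝ) ∞ (w j k) U) :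
    HasEndDeriv U X (fun x => quadGamma γ fun j k => w j k x)
      fun x => quadGamma γ fun j k => dirDeriv X (w j k) x := by
  simp only [quadGamma_eq_slash]
  exact hasEndDeriv_slash hU X fun b => hw (b 0) (b 1)

lemma isSmoothEnd_connEnd (hE : IsOrthonormalFrameOn g η E U) (hU : IsOpen U)
    (hA : IsSmoothCovector A) (a : Fin D) : IsSmoothEnd D U (connEnd g E γ A e a) :=
  ((isSmoothEnd_quadGamma fun j k => hE.smooth_connCoeff hU a j k).smul contMDiffOn_const).sub
    ((isSmoothEnd_const _).smul (hA U _ hU (hE.smooth a)))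

lemma hasEndDeriv_connEnd (hE : IsOrthonormalFrameOn g η E U) (hU : IsOpen U)
    (hA : IsSmoothCovector A) (X : VField D M) (a : Fin D) :
    HasEndDeriv U X (connEnd g E γ A e a) fun x =>
      (1 / 4 : ℝ) • quadGamma γ (fun j k => dirDeriv X (connCoeff g E a j k) x)
        - dirDeriv X (fun y => A y (E a y)) x • ((Complex.I * (e : ℂ)) • (1 : Module.End ℂ S)) := by
  have hq : IsSmoothEnd D U fun x => quadGamma γ fun j k => connCoeff g E a j k x :=
    isSmoothEnd_quadGamma fun j k => hE.smooth_connCoeff hU a j k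
  have hAs := hA U _ hU (hE.smooth a)
  exact HasEndDeriv.sub hU (hq.smul contMDiffOn_const) ((isSmoothEnd_const _).smul hAs)
    ((hasEndDeriv_quadGamma hU X fun j k => hE.smooth_connCoeff hU a j k).const_smul hU hq _)
    (hasEndDeriv_smul_const hU X _ hAs)

/-- The electromagnetic part of the connection is a scalar and drops out. -/
lemma connEnd_commutator (g : PseudoMetric D M) (E : Fin D → VField D M)
    (γ : Fin D → Module.End ℂ S) (A : CovectorField D M) (e : ℝ) (a : Fin D) (x : M)
    (R : Module.End ℂ S) :
    connEnd g E γ A e a x * R - R * connEnd g E γ A e a x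
      = (1 / 4 : ℝ) • (quadGamma γ (fun j k => connCoeff g E a j k x) * R
        - R * quadGamma γ fun j k => connCoeff g E a j k x) := by
  simp only [connEnd, sub_mul, mul_sub, smul_mul_assoc, mul_smul_comm, one_mul, mul_one, smul_sub]
  abel

/-- The curvature of the charged spin connection. -/
lemma curvature_connEnd (hγ : IsClifford γ η) (hE : IsOrthonormalFrameOn g η E U)
    (hη : ∀ i, η i = 1 ∨ η i = -1) (hU : IsOpen U) {x : M} (hx : x ∈ U) (a b : Fin D) :
    ((1 / 4 : ℝ) • quadGamma γ (fun j k => dirDeriv (E a) (connCoeff g E b j k) x)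
        - dirDeriv (E a) (fun y => A y (E b y)) x • ((Complex.I * (e : ℂ)) • (1 : Module.End ℂ S)))
      - ((1 / 4 : ℝ) • quadGamma γ (fun j k => dirDeriv (E b) (connCoeff g E a j k) x)
        - dirDeriv (E b) (fun y => A y (E a y)) x • ((Complex.I * (e : ℂ)) • (1 : Module.End ℂ S)))
      + (connEnd g E γ A e a x * connEnd g E γ A e b x
        - connEnd g E γ A e b x * connEnd g E γ A e a x)
      - ∑ m, structCoeff g η E a b m x • connEnd g E γ A e m x
    = (1 / 4 : ℝ) • curvatureGamma γ (riemann g η E x) a b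
      - fieldStrength A (E a) (E b) x • ((Complex.I * (e : ℂ)) • (1 : Module.End ℂ S)) := by
  set J := (Complex.I * (e : ℂ)) • (1 : Module.End ℂ S) with hJ
  have hF : fieldStrength A (E a) (E b) x = dirDeriv (E a) (fun y => A y (E b y)) x
      - dirDeriv (E b) (fun y => A y (E a y)) x - ∑ m, structCoeff g η E a b m x * A x (E m x) := by
    rw [fieldStrength, hE.bracket_eq_sum hη hU hx a b]
    simp only [map_sum, map_smul, smul_eq_mul]
  have hR : curvatureGamma γ (riemann g η E x) a b
      = quadGamma γ (fun j k => dirDeriv (E a) (connCoeff g E b j k) x)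
        - quadGamma γ (fun j k => dirDeriv (E b) (connCoeff g E a j k) x)
        - ∑ m, structCoeff g η E a b m x • quadGamma γ (fun j k => connCoeff g E m j k x)
        + quadGamma γ fun j k => ∑ l, η l * (connCoeff g E a j l x * connCoeff g E b l k x
          - connCoeff g E b j l x * connCoeff g E a l k x) := by
    simp only [← quadGamma_smul, ← quadGamma_sum, ← quadGamma_sub, ← quadGamma_add]
    rfl
  -- The two factors `1/4` meet the `4` of `quadGamma_commutator`.
  have hc : connEnd g E γ A e a x * connEnd g E γ A e b x
        - connEnd g E γ A e b x * connEnd g E γ A e a x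
      = (1 / 4 : ℝ) • quadGamma γ fun j k => ∑ l, η l *
        (connCoeff g E a j l x * connCoeff g E b l k x
          - connCoeff g E b j l x * connCoeff g E a l k x) := by
    have h := connEnd_commutator g E γ A e b x (quadGamma γ fun j k => connCoeff g E a j k x)
    rw [connEnd_commutator, ← neg_sub, h, ← smul_neg, neg_sub,
      quadGamma_commutator hγ fun j k => hE.connCoeff_antisymm hU hx a j k]
    module
  have hs : ∑ m, structCoeff g η E a b m x • connEnd g E γ A e m x
      = (1 / 4 : ℝ) • ∑ m, structCoeff g η E a b m x •
          quadGamma γ (fun j k => connCoeff g E m j k x)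
        - (∑ m, structCoeff g η E a b m x * A x (E m x)) • J := by
    simp only [connEnd, ← hJ, smul_sub, Finset.sum_sub_distrib, Finset.smul_sum, Finset.sum_smul,
      smul_smul]
    congr 1
    exact Finset.sum_congr rfl fun m _ => by rw [mul_comm]
  rw [hc, hs, hR, hF]
  module

end LocalOperators

/-! ### The Dirac algebra realized by charged covariant derivatives. -/

section ChargedOperators

variable {D : ℕ} {M : Type*} [TopologicalSpace M] [ChartedSpace (EuclideanSpace ℝ (Fin D)) M]
  [IsManifold (𝓡 D) ∞ M] {g : PseudoMetric D M} {η : Fin D → ℝ} {E : Fin D → VField D M}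
  {U : Set M} {S : Type*} [NormedAddCommGroup S] [NormedSpace ℂ S] [FiniteDimensional ℂ S]
  {γ : Fin D → Module.End ℂ S} {A : CovectorField D M}

/-- The charged covariant derivative on sections. -/
def nablaOp (hE : IsOrthonormalFrameOn g η E U) (hU : IsOpen U) (hA : IsSmoothCovector A)
    (γ : Fin D → Module.End ℂ S) (e : ℝ) (a : Fin D) : Module.End ℝ (smoothSections D S U) :=
  derivOp hU (E a) (hE.smooth a) + mulOp (connEnd g E γ A e a) (isSmoothEnd_connEnd hE hU hA a)

/-- The gamma matrices as operators on sections. -/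
def gammaOp (U : Set M) (γ : Fin D → Module.End ℂ S) (a : Fin D) :
    Module.End ℝ (smoothSections D S U) :=
  mulOp (fun _ => γ a) (isSmoothEnd_const _)

/-- The connection coefficients as operators on sections. -/
def coeffOp (S : Type*) [NormedAddCommGroup S] [NormedSpace ℂ S] [FiniteDimensional ℂ S]
    (hE : IsOrthonormalFrameOn g η E U) (hU : IsOpen U) (a b c : Fin D) :
    Module.End ℝ (smoothSections D S U) :=
  mulOp (fun x => connCoeff g E a b c x • (1 : Module.End ℂ S))
    ((isSmoothEnd_const _).smul (hE.smooth_connCoeff hU a b c))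

/-- Clifford multiplication by a form. -/
def slashOp (hE : IsOrthonormalFrameOn g η E U) (hU : IsOpen U) (γ : Fin D → Module.End ℂ S)
    {k : ℕ} {Y : FormField D M k} (hY : IsSmoothForm Y) : Module.End ℝ (smoothSections D S U) :=
  mulOp (fun x => slash γ (formComp E Y x)) (isSmoothEnd_slash (smooth_formComp hE hU hY))

lemma isClifford_gammaOp (hγ : IsClifford γ η) : IsClifford (gammaOp U γ) η := fun a b =>
  IsMulBy.ext (((isMulBy_mulOp _ _).mul (isMulBy_mulOp _ _)).add
    ((isMulBy_mulOp _ _).mul (isMulBy_mulOp _ _))) (isMulBy_one.smul _) fun _ _ => hγ a b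

lemma isMulBy_commutator_nablaOp (hE : IsOrthonormalFrameOn g η E U) (hU : IsOpen U)
    (hA : IsSmoothCovector A) {e : ℝ} {a : Fin D} {O : Module.End ℝ (smoothSections D S U)}
    {L L' : M → Module.End ℂ S} (hO : IsMulBy O L) (h : HasEndDeriv U (E a) L L') :
    IsMulBy (nablaOp hE hU hA γ e a * O - O * nablaOp hE hU hA γ e a) fun x =>
      L' x + (1 / 4 : ℝ) • (quadGamma γ (fun j k => connCoeff g E a j k x) * L x
        - L x * quadGamma γ fun j k => connCoeff g E a j k x) := by
  have h1 := hO.commutator_derivOp hU (hE.smooth a) h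
  have hc := isMulBy_mulOp (connEnd g E γ A e a) (isSmoothEnd_connEnd hE hU hA a)
  have h2 := h1.add ((hc.mul hO).sub (hO.mul hc))
  have e1 : nablaOp hE hU hA γ e a * O - O * nablaOp hE hU hA γ e a
      = derivOp hU (E a) (hE.smooth a) * O - O * derivOp hU (E a) (hE.smooth a)
        + (mulOp (connEnd g E γ A e a) (isSmoothEnd_connEnd hE hU hA a) * O
          - O * mulOp (connEnd g E γ A e a) (isSmoothEnd_connEnd hE hU hA a)) := by
    simp only [nablaOp]
    noncomm_ring
  rw [e1]
  exact h2.congr fun x _ => by rw [connEnd_commutator]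

variable {e : ℝ}

/-- Clifford multiplication is parallel: the commutator with the spin connection reproduces the
Levi-Civita terms of `∇Y`, since `(1/4) * (-4) = -1`. -/
lemma isMulBy_dElt_slashOp (hγ : IsClifford γ η) (hE : IsOrthonormalFrameOn g η E U)
    (hU : IsOpen U) (hA : IsSmoothCovector A) {k : ℕ} {Y : FormField D M k} (hY : IsSmoothForm Y)
    (a : Fin D) :
    IsMulBy (dElt (nablaOp hE hU hA γ e) (slashOp hE hU γ hY) a) fun x =>
      slash γ fun b => covDerivForm g η E Y x (Fin.cons a b) := by
  refine (isMulBy_commutator_nablaOp hE hU hA (isMulBy_mulOp _ _)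
    (hasEndDeriv_slash hU (E a) (smooth_formComp hE hU hY))).congr fun x hx => ?_
  rw [quadGamma, commutator_quadratic_slash hγ fun j k => hE.connCoeff_antisymm hU hx a j k,
    ← slash_smul, ← slash_add]
  congr 1
  funext b
  rw [covDerivForm_cons]
  congr 1
  simp only [derivAction, Finset.mul_sum]
  refine Finset.sum_congr rfl fun i _ => Finset.sum_congr rfl fun l _ => ?_
  ring

lemma isMulBy_diracElt_slashOp (hγ : IsClifford γ η) (hE : IsOrthonormalFrameOn g η E U)
    (hU : IsOpen U) (hA : IsSmoothCovector A) {k : ℕ} {Y : FormField D M k} (hY : IsSmoothForm Y) :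
    IsMulBy (diracElt (gammaOp U γ) (nablaOp hE hU hA γ e) (slashOp hE hU γ hY)) fun x =>
      slash γ (covDerivForm g η E Y x) :=
  (IsMulBy.sum _ fun c => (isMulBy_mulOp _ _).mul
    (isMulBy_dElt_slashOp hγ hE hU hA hY c)).congr fun _ _ => (slash_succ γ _).symm

lemma isMulBy_curv (hγ : IsClifford γ η) (hE : IsOrthonormalFrameOn g η E U)
    (hη : ∀ i, η i = 1 ∨ η i = -1) (hU : IsOpen U) (hA : IsSmoothCovector A) (a b : Fin D) :
    IsMulBy (curv (nablaOp hE hU hA γ e) η (coeffOp S hE hU) a b) fun x =>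
      (1 / 4 : ℝ) • curvatureGamma γ (riemann g η E x) a b
        - fieldStrength A (E a) (E b) x • ((Complex.I * (e : ℂ)) • (1 : Module.End ℂ S)) := by
  set d : Fin D → Module.End ℝ (smoothSections D S U) := fun i => derivOp hU (E i) (hE.smooth i)
    with hd
  set c : Fin D → Module.End ℝ (smoothSections D S U) := fun i =>
    mulOp (connEnd g E γ A e i) (isSmoothEnd_connEnd hE hU hA i) with hc
  set w : Fin D → Fin D → Fin D → Module.End ℝ (smoothSections D S U) := coeffOp S hE hU with hw
  have hwm : ∀ m, IsMulBy (η m • (w a m b - w b m a)) fun x =>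
      structCoeff g η E a b m x • (1 : Module.End ℂ S) := fun m =>
    (((isMulBy_mulOp _ _).sub (isMulBy_mulOp _ _)).smul (η m)).congr fun x _ => by
      rw [← sub_smul, smul_smul]
      rfl
  -- Frame derivatives commute up to the structure functions, so this part of the curvature is zero.
  have h0 : IsMulBy (d a * d b - d b * d a - ∑ m, η m • ((w a m b - w b m a) * d m))
      fun _ => (0 : Module.End ℂ S) := by
    intro v x hx
    have h1 : ∀ i j, (d i (d j v)).1 x = dirDeriv (E i) (dirDeriv (E j) v.1) x := fun i j => by
      rw [hd, derivOp_apply hU _ _ _ hx]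
      exact dirDeriv_congr hU (fun y hy => derivOp_apply hU _ _ _ hy) hx
    have h2 : ∀ m, ((η m • (w a m b - w b m a)) (d m v)).1 x
        = structCoeff g η E a b m x • dirDeriv (E m) v.1 x := fun m => by
      rw [hwm m _ x hx, hd, derivOp_apply hU _ _ _ hx]
      rfl
    simp only [← smul_mul_assoc, LinearMap.sub_apply, Module.End.mul_apply, LinearMap.sum_apply,
      Submodule.coe_sub, Submodule.coe_sum, Pi.sub_apply, Finset.sum_apply]
    rw [Finset.sum_congr rfl fun m _ => h2 m, h1, h1,
      hE.dirDeriv_commutator hη hU v.2.1 hx, sub_self]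
    rfl
  have hcm : ∀ i, IsMulBy (c i) (connEnd g E γ A e i) := fun i => isMulBy_mulOp _ _
  have hs : IsMulBy (∑ m, η m • ((w a m b - w b m a) * c m)) fun x =>
      ∑ m, structCoeff g η E a b m x • connEnd g E γ A e m x := by
    simp only [← smul_mul_assoc]
    exact (IsMulBy.sum _ fun m => (hwm m).mul (hcm m)).congr fun x _ => by
      simp only [smul_mul_assoc, one_mul]
  rw [show nablaOp hE hU hA γ e = fun i => d i + c i from rfl, curv_add]
  refine (h0.add (((((hcm b).commutator_derivOp hU (hE.smooth a)
    (hasEndDeriv_connEnd hE hU hA _ b)).sub ((hcm a).commutator_derivOp hU (hE.smooth b)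
    (hasEndDeriv_connEnd hE hU hA _ a))).add (((hcm a).mul (hcm b)).sub
    ((hcm b).mul (hcm a)))).sub hs)).congr fun x hx => ?_
  rw [zero_add]
  exact curvature_connEnd hγ hE hη hU hx a b

lemma diracAlgebra_nablaOp (hγ : IsClifford γ η) (hE : IsOrthonormalFrameOn g η E U)
    (hU : IsOpen U) (hA : IsSmoothCovector A) {k : ℕ} {Y : FormField D M k} (hY : IsSmoothForm Y) :
    DiracAlgebra (gammaOp U γ) (nablaOp hE hU hA γ e) η (coeffOp S hE hU)
      (slashOp hE hU γ hY) where
  clifford := isClifford_gammaOp hγ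
  antisymm a b c := (isMulBy_mulOp _ _).ext (isMulBy_mulOp _ _).neg fun x hx => by
    rw [hE.connCoeff_antisymm hU hx, neg_smul]
  comm_gamma a b c d := ((isMulBy_mulOp _ _).mul (isMulBy_mulOp _ _)).ext
    ((isMulBy_mulOp _ _).mul (isMulBy_mulOp _ _)) fun x hx => by
      rw [smul_mul_assoc, mul_smul_comm, one_mul, mul_one]
  comm_y a b c := ((isMulBy_mulOp _ _).mul (isMulBy_mulOp _ _)).ext
    ((isMulBy_mulOp _ _).mul (isMulBy_mulOp _ _)) fun x hx => by
      rw [smul_mul_assoc, mul_smul_comm, one_mul, mul_one]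
  comm_dy a b c d := ((isMulBy_mulOp _ _).mul (isMulBy_dElt_slashOp hγ hE hU hA hY d)).ext
    ((isMulBy_dElt_slashOp hγ hE hU hA hY d).mul (isMulBy_mulOp _ _)) fun x hx => by
      rw [smul_mul_assoc, mul_smul_comm, one_mul, mul_one]
  deriv_gamma a b := by
    refine (isMulBy_commutator_nablaOp hE hU hA (isMulBy_mulOp _ _)
      (hasEndDeriv_const hU (E a) (γ b))).ext (IsMulBy.neg (IsMulBy.sum _ fun c =>
        ((isMulBy_mulOp _ _).mul (isMulBy_mulOp _ _)).smul (η b))) fun x hx => ?_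
    rw [quadGamma, commutator_quadratic_gamma hγ fun j k => hE.connCoeff_antisymm hU hx a j k,
      zero_add, Finset.smul_sum, ← Finset.sum_neg_distrib]
    refine Finset.sum_congr rfl fun c _ => ?_
    rw [smul_mul_assoc, one_mul]
    module

/-- The symmetry operator of a form on sections. -/
def symmetryOp (hE : IsOrthonormalFrameOn g η E U) (hU : IsOpen U) (hA : IsSmoothCovector A)
    (γ : Fin D → Module.End ℂ S) (e : ℝ) {n : ℕ} {Y : FormField D M (n + 1)}
    (hY : IsSmoothForm Y) : Module.End ℝ (smoothSections D S U) :=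
  ∑ a, mulOp (fun x => η a • slash γ fun b : Fin n → Fin D => formComp E Y x (Fin.cons a b))
      ((isSmoothEnd_slash fun b => smooth_formComp hE hU hY (Fin.cons a b)).smul contMDiffOn_const)
      * nablaOp hE hU hA γ e a
    + (1 / (2 * ((n + 1 : ℕ) + 1)) : ℝ) •
      diracElt (gammaOp U γ) (nablaOp hE hU hA γ e) (slashOp hE hU γ hY)

theorem graded_anticommute_symmetryOp (hγ : IsClifford γ η) (hE : IsOrthonormalFrameOn g η E U)
    (hη : ∀ i, η i = 1 ∨ η i = -1) (hU : IsOpen U) (hA : IsSmoothCovector A) {n : ℕ}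
    {Y : FormField D M (n + 1)} (hY : IsSmoothForm Y) (hKY : IsKillingYano g η Y)
    (hlift : LiftCondition g η A Y) :
    (∑ a, gammaOp U γ a * nablaOp hE hU hA γ e a) * symmetryOp hE hU hA γ e hY
      + (-1 : ℝ) ^ (n + 1) •
        (symmetryOp hE hU hA γ e hY * ∑ a, gammaOp U γ a * nablaOp hE hU hA γ e a) = 0 := by
  have hDA := diracAlgebra_nablaOp (e := e) hγ hE hU hA hY
  set N := nablaOp hE hU hA γ e with hN
  set y := slashOp hE hU γ hY with hy
  set G := gammaOp U γ with hG
  set P := ∑ a, G a * N a with hP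
  set t := diracElt G N y with ht
  have hGm : ∀ a, IsMulBy (G a) fun _ => γ a := fun a => isMulBy_mulOp _ _
  have hym : IsMulBy y fun x => slash γ (formComp E Y x) := isMulBy_mulOp _ _
  have hdm := isMulBy_dElt_slashOp (e := e) hγ hE hU hA hY
  have htm := isMulBy_diracElt_slashOp (e := e) hγ hE hU hA hY
  have hcm := isMulBy_curv (e := e) hγ hE hη hU hA
  have hR : ∀ x ∈ U, IsRiemannTensor (riemann g η E x) := fun x hx => hE.isRiemannTensor hη hU hx
  -- The Killing–Yano equation is used only through this total antisymmetry.
  have hT : ∀ x ∈ U, IsAlternating (covDerivForm g η E Y x) := fun x hx => by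
    rw [show covDerivForm g η E Y x = antisymm (covDerivForm g η E Y x) from
      funext fun c => hKY U E hU hE x hx c]
    exact isAlternating_antisymm _
  have hε : (-1 : ℝ) ^ (n + 1) * (-1 : ℝ) ^ (n + 1) = 1 := by
    rw [← mul_pow]
    simp
  -- Here `r = p + 1 = n + 2` is the degree of `∇Y`, and its graded commutator carries the sign
  -- `(-1)^p`.
  have hi : ∀ c, (2 * (n + 2 : ℝ) * η c) • dElt N y c = G c * t + (-1 : ℝ) ^ (n + 1) • (t * G c) :=
    fun c => ((hdm c).smul _).ext (((hGm c).mul htm).add ((htm.mul (hGm c)).smul _))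
      fun x hx => by
        rw [graded_commutator_slash hγ c (hT x hx)]
        congr 2
        push_cast
        ring
  have hii : ∑ a, dElt N y a * G a = (-1 : ℝ) ^ (n + 1) • t :=
    (IsMulBy.sum _ fun a => (hdm a).mul (hGm a)).ext (htm.smul _)
      fun x hx => sum_slash_mul_gamma hγ (hT x hx)
  have hΩ : ∑ a, ∑ c, G c * (curv N η (coeffOp S hE hU) a c * y
      - y * curv N η (coeffOp S hE hU) a c) * G a = 0 := by
    refine (IsMulBy.sum _ fun a => IsMulBy.sum _ fun c => ((hGm c).mul
      (((hcm a c).mul hym).sub (hym.mul (hcm a c)))).mul (hGm a)).ext isMulBy_zero fun x hx => ?_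
    have h := congrArg ((1 / 4 : ℝ) • ·) (sum_gamma_commutator_curvatureGamma hγ (hR x hx)
      (slash γ (formComp E Y x)))
    simp only [smul_zero, Finset.smul_sum] at h
    rw [← h]
    refine Finset.sum_congr rfl fun a _ => Finset.sum_congr rfl fun c _ => ?_
    rw [← smul_mul_assoc, ← mul_smul_comm]
    congr 2
    simp only [sub_mul, mul_sub, smul_mul_assoc, mul_smul_comm, one_mul, mul_one, smul_sub]
    abel
  have hΩ' : (∑ a, ∑ c, G a * G c * curv N η (coeffOp S hE hU) a c) * y
      = y * ∑ a, ∑ c, G a * G c * curv N η (coeffOp S hE hU) a c := by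
    have h1 := IsMulBy.sum Finset.univ fun a => IsMulBy.sum Finset.univ fun c =>
      ((hGm a).mul (hGm c)).mul (hcm a c)
    refine (h1.mul hym).ext (hym.mul h1) fun x hx => ?_
    have h2 : ∑ a, ∑ c, γ a * γ c * ((1 / 4 : ℝ) • curvatureGamma γ (riemann g η E x) a c
        - fieldStrength A (E a) (E c) x • ((Complex.I * (e : ℂ)) • (1 : Module.End ℂ S)))
        = (1 / 4 : ℝ) • ((2 * ∑ a, η a * ricci η (riemann g η E x) a a) • (1 : Module.End ℂ S))
          - (Complex.I * (e : ℂ)) • ∑ a, ∑ c, fieldStrength A (E a) (E c) x • (γ a * γ c) := by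
      rw [← sum_gamma_gamma_curvatureGamma hγ (hR x hx)]
      simp only [mul_sub, Finset.sum_sub_distrib, mul_smul_comm, mul_one, Finset.smul_sum,
        smul_comm (Complex.I * (e : ℂ))]
    -- The scalar-curvature term commutes with everything; the field-strength term commutes with `y`
    -- by the condition on `F` and `Y`.
    have h3 := commutator_quadratic_slash hγ
      (fun a c => fieldStrength_swap A (E a) (E c) x) (formComp E Y x)
    have h4 : derivAction (fun l j => -4 * η l * fieldStrength A (E l) (E j) x) (formComp E Y x)
        = fun b => -4 * derivAction (fun l j => η l * fieldStrength A (E l) (E j) x)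
          (formComp E Y x) b := by
      funext b
      simp only [derivAction, Finset.mul_sum, mul_assoc]
    rw [h4, slash_smul, derivAction_fieldStrength_eq_zero hU hE hlift hx] at h3
    have h5 : slash γ (0 : (Fin (n + 1) → Fin D) → ℝ) = 0 := by simp [slash]
    rw [h5, smul_zero, sub_eq_zero] at h3
    rw [h2, sub_mul, mul_sub]
    simp only [smul_mul_assoc, mul_smul_comm, one_mul, mul_one, h3]
  have hZ : ∀ a, (2 * (n + 1 : ℝ)) • mulOp (fun x => η a • slash γ fun b : Fin n → Fin D =>
        formComp E Y x (Fin.cons a b))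
        ((isSmoothEnd_slash fun b => smooth_formComp hE hU hY (Fin.cons a b)).smul
          contMDiffOn_const)
      = G a * y - (-1 : ℝ) ^ (n + 1) • (y * G a) := fun a =>
    ((isMulBy_mulOp _ _).smul _).ext (((hGm a).mul hym).sub ((hym.mul (hGm a)).smul _))
      fun x hx => by
        rw [gamma_mul_slash hγ a (isAlternating_formComp E Y x), smul_smul]
        abel
  have hr : (n + 2 : ℝ) ≠ 0 := by positivity
  have hK : (2 * (n + 1 : ℝ)) • symmetryOp hE hU hA γ e hY
      = P * y - (-1 : ℝ) ^ (n + 1) • (y * P) - (n + 2 : ℝ)⁻¹ • t := by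
    -- The coefficient `p / (p + 1)` of `t` in `2p K_Y`; combined with the `-t` from
    -- `sum_mul_N_of_smul_eq` it leaves `-1 / (p + 1)`.
    have h2 : (2 * (n + 1 : ℝ)) * (1 / (2 * ((n + 1 : ℕ) + 1)) : ℝ) = 1 - (n + 2 : ℝ)⁻¹ := by
      push_cast
      field_simp
      ring
    have h3 := sum_mul_N_of_smul_eq (N := N) hZ
    rw [symmetryOp, smul_add, smul_smul, h2]
    refine (congrArg (· + (1 - (n + 2 : ℝ)⁻¹) • t) h3).trans ?_
    module
  have h := hDA.graded_anticommute hε hr hi hii hΩ hΩ' hK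
  rw [mul_smul_comm, smul_mul_assoc, smul_comm _ (2 * (n + 1 : ℝ)), ← smul_add] at h
  exact (smul_eq_zero.1 h).resolve_left (by positivity)

end ChargedOperators

/-! ### From the local operators back to spinor fields. -/

section Spinors

variable {D : ℕ} {η : Fin D → ℝ}

lemma polar_signForm_single (η : Fin D → ℝ) (a b : Fin D) :
    QuadraticMap.polar (signForm η) (Pi.single a 1) (Pi.single b 1)
      = if a = b then 2 * η a else 0 := by
  simp only [QuadraticMap.polar, QuadraticMap.weightedSumSquares_apply, ← Finset.sum_sub_distrib,
    Pi.add_apply, Pi.single_apply, smul_eq_mul]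
  have h : ∀ i : Fin D, η i * (((if i = a then (1 : ℝ) else 0) + if i = b then (1 : ℝ) else 0)
      * ((if i = a then (1 : ℝ) else 0) + if i = b then (1 : ℝ) else 0))
      - η i * ((if i = a then (1 : ℝ) else 0) * if i = a then (1 : ℝ) else 0)
      - η i * ((if i = b then (1 : ℝ) else 0) * if i = b then (1 : ℝ) else 0)
      = if i = a then (if a = b then 2 * η a else 0) else 0 := by
    intro i
    by_cases h1 : i = a
    · subst h1
      by_cases h2 : i = b
      · simp only [h2, if_true]
        ring
      · simp [h2]
    · by_cases h2 : i = b
      · subst h2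
        simp [h1]
      · simp [h1, h2]
  simp only [h, Finset.sum_ite_eq', Finset.mem_univ, if_true]

variable {S : Type*} [NormedAddCommGroup S] [NormedSpace ℂ S]

/-- Raising both indices multiplies the relation by `η a * η b`, which is `1` on the diagonal. -/
lemma isClifford_gamma (hη : ∀ i, η i = 1 ∨ η i = -1)
    (ρ : CliffordAlgebra (signForm η) →ₐ[ℝ] Module.End ℂ S) : IsClifford (gamma ρ) η := by
  intro a b
  have h := congrArg ρ (CliffordAlgebra.ι_mul_ι_add_swap (Q := signForm η) (Pi.single a 1)
    (Pi.single b 1))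
  rw [polar_signForm_single, map_add, map_mul, map_mul, AlgHom.commutes,
    Algebra.algebraMap_eq_smul_one] at h
  have h1 : gamma ρ a * gamma ρ b + gamma ρ b * gamma ρ a
      = (η a * η b) • (ρ (cliffordBasis η a) * ρ (cliffordBasis η b)
        + ρ (cliffordBasis η b) * ρ (cliffordBasis η a)) := by
    simp only [gamma, smul_mul_assoc, mul_smul_comm, smul_add, smul_smul, mul_comm (η b)]
  rw [h1]
  refine (congrArg ((η a * η b) • ·) h).trans ?_
  rw [smul_smul]
  congr 1
  split_ifs with hab
  · subst hab
    rcases hη a with h | h <;> simp [h]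
  · simp

variable {M : Type*} [TopologicalSpace M] [ChartedSpace (EuclideanSpace ℝ (Fin D)) M]
  [IsManifold (𝓡 D) ∞ M] {g : PseudoMetric D M} {I : Type*} [FiniteDimensional ℂ S]
  (P : SpinStructure g η I) (ρ : CliffordAlgebra (signForm η) →ₐ[ℝ] Module.End ℂ S)
  {A : CovectorField D M} (hA : IsSmoothCovector A) (e : ℝ) {φ : I → M → S} {α : I}
  {u : smoothSections D S (P.dom α)}

lemma chargedDeriv_eq_nablaOp (hu : ∀ y ∈ P.dom α, φ α y = u.1 y) (a : Fin D) {x : M}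
    (hx : x ∈ P.dom α) :
    chargedDeriv P ρ A e a φ α x
      = (nablaOp (P.orthonormal α) (P.isOpen_dom α) hA (gamma ρ) e a u).1 x := by
  have h1 : (nablaOp (P.orthonormal α) (P.isOpen_dom α) hA (gamma ρ) e a u).1 x
      = dirDeriv (P.frame α a) u.1 x + connEnd g (P.frame α) (gamma ρ) A e a x (u.1 x) := by
    rw [← derivOp_apply (P.isOpen_dom α) _ ((P.orthonormal α).smooth a) u hx]
    rfl
  rw [h1, chargedDeriv, spinDeriv, dirDeriv_congr (P.isOpen_dom α) hu hx, hu x hx, connEnd,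
    quadGamma, add_sub_assoc]
  congr 1
  simp only [LinearMap.sub_apply, LinearMap.smul_apply, LinearMap.sum_apply, Module.End.one_apply]
  congr 1
  rw [mul_comm, mul_smul]
  exact Complex.coe_smul _ _

lemma diracOp_eq_nablaOp (hu : ∀ y ∈ P.dom α, φ α y = u.1 y) {x : M} (hx : x ∈ P.dom α) :
    diracOp P ρ A e φ α x = ((∑ a, gammaOp (P.dom α) (gamma ρ) a
      * nablaOp (P.orthonormal α) (P.isOpen_dom α) hA (gamma ρ) e a) u).1 x := by
  simp only [diracOp, LinearMap.sum_apply, Submodule.coe_sum, Finset.sum_apply,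
    chargedDeriv_eq_nablaOp P ρ hA e hu _ hx]
  rfl

/-- Both coefficient arrays are alternating, that of `∇Y` by the Killing–Yano equation, so the
antisymmetrized gamma products may be replaced by plain ones. -/
lemma kyOp_eq_symmetryOp {n : ℕ} {Y : FormField D M (n + 1)} (hY : IsSmoothForm Y)
    (hKY : IsKillingYano g η Y) (hu : ∀ y ∈ P.dom α, φ α y = u.1 y) {x : M} (hx : x ∈ P.dom α) :
    kyOp P ρ A e Y φ α x
      = (symmetryOp (P.orthonormal α) (P.isOpen_dom α) hA (gamma ρ) e hY u).1 x := by
  have hγ := isClifford_gamma P.signature ρ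
  have hT : IsAlternating (covDerivForm g η (P.frame α) Y x) := by
    rw [show covDerivForm g η (P.frame α) Y x = antisymm (covDerivForm g η (P.frame α) Y x) from
      funext fun c => hKY _ _ (P.isOpen_dom α) (P.orthonormal α) x hx c]
    exact isAlternating_antisymm _
  have h1 : ∀ (a : Fin D) (s : S),
      ∑ b : Fin n → Fin D, (η a * Y x (Fin.cons (P.frame α a x) fun k => P.frame α (b k) x)) •
        gammaAnti ρ b s
      = (η a • slash (gamma ρ) fun b : Fin n → Fin D =>
          formComp (P.frame α) Y x (Fin.cons a b)) s := by
    intro a s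
    have hc : ∀ b : Fin n → Fin D, Y x (Fin.cons (P.frame α a x) fun k => P.frame α (b k) x)
        = formComp (P.frame α) Y x (Fin.cons a b) := fun b => by
      rw [formComp]
      congr 1
      funext l
      refine Fin.cases rfl (fun _ => rfl) l
    rw [← sum_smul_antisymm_eq_slash _ ((isAlternating_formComp (P.frame α) Y x).cons a)]
    simp only [hc, LinearMap.smul_apply, LinearMap.sum_apply, Finset.smul_sum, smul_smul]
    rfl
  have h2 : ∀ s : S, ∑ b : Fin (n + 2) → Fin D,
      covDerivForm g η (P.frame α) Y x b • gammaAnti ρ b s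
      = slash (gamma ρ) (covDerivForm g η (P.frame α) Y x) s := by
    intro s
    rw [← sum_smul_antisymm_eq_slash _ hT]
    simp only [LinearMap.smul_apply, LinearMap.sum_apply]
    rfl
  have h3 := isMulBy_diracElt_slashOp (e := e) hγ (P.orthonormal α) (P.isOpen_dom α) hA hY u x hx
  rw [kyOp, Finset.sum_comm, h2, hu x hx, ← h3]
  simp only [h1, chargedDeriv_eq_nablaOp P ρ hA e hu _ hx]
  simp only [symmetryOp, LinearMap.add_apply, LinearMap.sum_apply, Submodule.coe_add,
    Submodule.coe_sum, Pi.add_apply, Finset.sum_apply]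
  rfl

end Spinors

end KillingYano

end


theorem mainTheorem5 {D n : ℕ} {M : Type*} [TopologicalSpace M]
    [ChartedSpace (EuclideanSpace ℝ (Fin D)) M] [IsManifold (𝓡 D) ∞ M]
    (g : KillingYano.PseudoMetric D M) (η : Fin D → ℝ)
    {I : Type*} (P : KillingYano.SpinStructure g η I)
    {S : Type*} [NormedAddCommGroup S] [NormedSpace ℂ S] [FiniteDimensional ℂ S]
    (ρ : CliffordAlgebra (KillingYano.signForm η) →ₐ[ℝ] Module.End ℂ S)
    (A : KillingYano.CovectorField D M) (hA : KillingYano.IsSmoothCovector A) (e : ℝ)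
    (Y : KillingYano.FormField D M (n + 1)) (hY : KillingYano.IsSmoothForm Y)
    (hKY : KillingYano.IsKillingYano g η Y) (hlift : KillingYano.LiftCondition g η A Y)
    (ψ : I → M → S) (hψ : KillingYano.IsSpinorField P ρ ψ) :
    ∀ α, ∀ x ∈ P.dom α,
      KillingYano.diracOp P ρ A e (KillingYano.kyOp P ρ A e Y ψ) α x
        + (-1 : ℝ) ^ (n + 1) •
          KillingYano.kyOp P ρ A e Y (KillingYano.diracOp P ρ A e ψ) α x = 0 := by
  intro α x hx
  -- The claim is local: on one trivialization the spinor is replaced by its extension by zero,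
  -- which is a section in the operator ring's domain.
  set v : KillingYano.smoothSections D S (P.dom α) :=
    ⟨_, KillingYano.indicator_mem_sections (hψ.smooth α)⟩
  have hv : ∀ y ∈ P.dom α, ψ α y = v.1 y := fun y hy => (Set.indicator_of_mem hy _).symm
  rw [KillingYano.diracOp_eq_nablaOp P ρ hA e
      (fun y hy => KillingYano.kyOp_eq_symmetryOp P ρ hA e hY hKY hv hy) hx,
    KillingYano.kyOp_eq_symmetryOp P ρ hA e hY hKY
      (fun y hy => KillingYano.diracOp_eq_nablaOp P ρ hA e hv hy) hx]
  exact congrFun (congrArg Subtype.val (LinearMap.congr_fun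
    (KillingYano.graded_anticommute_symmetryOp (e := e)
      (KillingYano.isClifford_gamma P.signature ρ) (P.orthonormal α) P.signature
      (P.isOpen_dom α) hA hY hKY hlift) v)) x
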